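/- Let $T>0$, $n,m,r\in\mathbb N$, $B\in\mathbb R^{n\times m}$, $C\in\mathbb R^{r\times n}$, $x_0\in\mathbb R^n$, and for $k=1,\dots,N$ ($N\ge 1$) let $A_k\in\mathbb R^{n\times n}$ and let $\Gamma_k\in\mathbb R^{n\times n}$, $R_k\in\mathbb R^{m\times m}$, $Q_k\in\mathbb R^{r\times r}$ be symmetric positive definite. Write $\|x\|_S^2=x^\top S x$. Let $\Pi_k$ be the solution on $[0,T]$ of $$\dot\Pi_k=A_k\Pi_k+\Pi_kA_k^\top-\Pi_kC^\top Q_k^{-1}C\Pi_k+BR_kB^\top,\qquad \Pi_k(0)=\Gamma_k,$$ and $P_k=\Pi_k^{-1}$. For an output $y\in L^2(0,T;\mathbb R^r)$ let $\widehat x_k$ be the (absolutely continuous) solution on $[0,T]$ of $$\dot{\widehat x}_k=A_k\widehat x_k+\Pi_kC^\top Q_k^{-1}(y-C\widehat x_k),\qquad \widehat x_k(0)=x_0,$$ and put $$\mathcal V_k(t,x)=\|x-\widehat x_k(t)\|_{P_k(t)}^2+\int_0^t\|y(s)-C\widehat x_k(s)\|_{Q_k^{-1}}^2\,\mathrm ds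 .$$ For $\theta\in(0,\infty)$ and $t\in[0,T]$ let $\widehat x_\theta(t)$ be the unique minimizer over $x\in\mathbb R^n$ of the entropic risk $\frac1\theta\ln\bigl(\frac1N\sum_{k=1}^N e^{\theta\mathcal V_k(t,x)}\bigr)$. Then: 1. If $y\in L^{2p}(0,T;\mathbb R^r)$ with an integer $1\le p<\infty$, then $\widehat x_\theta\in W^{1,p}(0,T;\mathbb R^n)$. 2. If $y\in C([0,T];\mathbb R^r)$, then $\widehat x_\theta\in C^1([0,T];\mathbb R^n)$. In both settings $M(t,\widehat x_\theta(t))$ is invertible for every $t\in[0,T]$ and the derivative (the weak derivative in 1., the classical one at every $t\in[0,T]$, one-sided at the end points, in 2.) is $$\dot{\widehat x}_\theta(t)=-M(t,\widehat x_\theta(t))^{-1}\,V(t,\widehat x_\theta(t)),$$ where $$M(t,x)=\sum_{k=1}^N e^{\theta\mathcal V_k(t,x)}\Bigl(P_k(t)+2\theta\,P_k(t)(x-\widehat x_k(t))(x-\widehat x_k(t))^\top P_k(t)\Bigr)$$ and $$\begin{aligned}V(t,x)=&-\sum_{k=1}^N e^{\theta\mathcal V_k(t,x)}\Bigl(P_k(t)\dot{\widehat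 x}_k(t)-\dot P_k(t)(x-\widehat x_k(t))\Bigr)\\&+\theta\sum_{k=1}^N e^{\theta\mathcal V_k(t,x)}\Bigl(\|y(t)-C\widehat x_k(t)\|_{Q_k^{-1}}^2-2\langle x-\widehat x_k(t),P_k(t)\dot{\widehat x}_k(t)\rangle+\langle x-\widehat x_k(t),\dot P_k(t)(x-\widehat x_k(t))\rangle\Bigr)P_k(t)(x-\widehat x_k(t)).\end{aligned}$$ -/

import Mathlib

open MeasureTheory Set Matrix
open scoped ContDiff ENNReal

/-- A finite family, indexed by `ι`, of linear systems on a horizon `[0, T]`: common input and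
output matrices `B`, `C` and initial guess `x₀`, uncertain system matrices `A k` and uncertain
symmetric positive definite covariances `Γ k`, `R k`, `Q k`. -/
structure UncertainSystem (ι : Type*) (n m r : ℕ) where
  T : ℝ
  T_pos : 0 < T
  A : ι → Matrix (Fin n) (Fin n) ℝ
  B : Matrix (Fin n) (Fin m) ℝ
  C : Matrix (Fin r) (Fin n) ℝ
  Γ : ι → Matrix (Fin n) (Fin n) ℝ
  R : ι → Matrix (Fin m) (Fin m) ℝ
  Q : ι → Matrix (Fin r) (Fin r) ℝ
  x₀ : Fin n → ℝ
  Γ_posDef : ∀ k, (Γ k).PosDef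
  R_posDef : ∀ k, (R k).PosDef
  Q_posDef : ∀ k, (Q k).PosDef

/-- The squared weighted norm `‖x‖²_M = xᵀ M x`. -/
def wnormSq {d : ℕ} (M : Matrix (Fin d) (Fin d) ℝ) (x : Fin d → ℝ) : ℝ := x ⬝ᵥ (M *ᵥ x)

/-- The entropic risk `θ⁻¹ ln (𝔼 [exp (θ X)])` of a random variable on a finite set that carries
the uniform distribution. -/
noncomputable def entropicRisk {ι : Type*} [Fintype ι] (θ : ℝ) (X : ι → ℝ) : ℝ :=
  (1 / θ) * Real.log ((1 / (Fintype.card ι : ℝ)) * ∑ k, Real.exp (θ * X k))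

namespace UncertainSystem

variable {ι : Type*} {n m r : ℕ} (S : UncertainSystem ι n m r)

/-- `Pi` solves, on `[0, T]`, the differential Riccati equation
`Π' = A Π + Π Aᵀ - Π Cᵀ Q⁻¹ C Π + B R Bᵀ`, `Π(0) = Γ` of the `k`-th system (derivatives are taken
entrywise, one-sided at the end points). -/
def IsRiccatiSolution (k : ι) (Pi : ℝ → Matrix (Fin n) (Fin n) ℝ) : Prop :=
  Pi 0 = S.Γ k ∧ ∀ t ∈ Icc 0 S.T, ∀ i j,
    HasDerivWithinAt (fun s => Pi s i j)
      ((S.A k * Pi t + Pi t * (S.A k)ᵀ - Pi t * S.Cᵀ * (S.Q k)⁻¹ * S.C * Pi t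
        + S.B * S.R k * S.Bᵀ) i j) (Icc 0 S.T) t

/-- The covariance `Π_k`: the solution of the Riccati equation (relevant on `[0, T]` only). -/
noncomputable def covariance (k : ι) : ℝ → Matrix (Fin n) (Fin n) ℝ :=
  Classical.epsilon (S.IsRiccatiSolution k)

/-- The precision matrix `P_k = Π_k⁻¹`. -/
noncomputable def precision (k : ι) (t : ℝ) : Matrix (Fin n) (Fin n) ℝ := (S.covariance k t)⁻¹

/-- The time derivative of `P_k` (one-sided at the end points of `[0, T]`). -/
noncomputable def precisionDeriv (k : ι) (t : ℝ) : Matrix (Fin n) (Fin n) ℝ :=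
  Matrix.of fun i j => derivWithin (fun s => S.precision k s i j) (Icc 0 S.T) t

/-- `x` solves, on `[0, T]`, the Kalman filter equation
`x' = A x + Π Cᵀ Q⁻¹ (y - C x)`, `x(0) = x₀` of the `k`-th system for the output `y`, in the
sense of Carathéodory (`y` need not be continuous). -/
def IsKalmanFilter (y : ℝ → Fin r → ℝ) (k : ι) (x : ℝ → Fin n → ℝ) : Prop :=
  ContinuousOn x (Icc 0 S.T) ∧ ∀ t ∈ Icc 0 S.T,
    x t = S.x₀ + ∫ s in (0 : ℝ)..t,
      (S.A k *ᵥ x s + (S.covariance k s * S.Cᵀ * (S.Q k)⁻¹) *ᵥ (y s - S.C *ᵥ x s))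

/-- The Kalman filter trajectory of the `k`-th system for the output `y`
(relevant on `[0, T]` only). -/
noncomputable def kalman (y : ℝ → Fin r → ℝ) (k : ι) : ℝ → Fin n → ℝ :=
  Classical.epsilon (S.IsKalmanFilter y k)

/-- The time derivative of the Kalman filter trajectory. The trajectory is absolutely continuous,
so this function represents its weak derivative. -/
noncomputable def kalmanDeriv (y : ℝ → Fin r → ℝ) (k : ι) (t : ℝ) : Fin n → ℝ :=
  derivWithin (S.kalman y k) (Icc 0 S.T) t

/-- The accumulated residual `r_k(t) = ∫₀ᵗ ‖y - C x̂_k‖²_{Q_k⁻¹}`. -/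
noncomputable def residual (y : ℝ → Fin r → ℝ) (k : ι) (t : ℝ) : ℝ :=
  ∫ s in (0 : ℝ)..t, wnormSq (S.Q k)⁻¹ (y s - S.C *ᵥ S.kalman y k s)

/-- The energy (value function) `𝒱_k(t, x) = ‖x - x̂_k(t)‖²_{P_k(t)} + r_k(t)`. -/
noncomputable def energy (y : ℝ → Fin r → ℝ) (k : ι) (t : ℝ) (x : Fin n → ℝ) : ℝ :=
  wnormSq (S.precision k t) (x - S.kalman y k t) + S.residual y k t

variable [Fintype ι]

/-- The estimator `x̂_θ(t)`: the minimizer over `x ∈ ℝⁿ` of the entropic risk of the energy. -/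
noncomputable def estimator (θ : ℝ) (y : ℝ → Fin r → ℝ) (t : ℝ) : Fin n → ℝ :=
  Classical.epsilon fun x : Fin n → ℝ =>
    IsMinOn (fun z => entropicRisk θ fun k => S.energy y k t z) univ x

/-- `M(t, x) = ∑ₖ exp(θ 𝒱ₖ) (Pₖ + 2 θ Pₖ (x - x̂ₖ) ⊗ (x - x̂ₖ) Pₖ)`. -/
noncomputable def matM (θ : ℝ) (y : ℝ → Fin r → ℝ) (t : ℝ) (x : Fin n → ℝ) :
    Matrix (Fin n) (Fin n) ℝ :=
  ∑ k, Real.exp (θ * S.energy y k t x) •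
    (S.precision k t + (2 * θ) • (S.precision k t *
      vecMulVec (x - S.kalman y k t) (x - S.kalman y k t) * S.precision k t))

/-- `V(t, x) = - ∑ₖ exp(θ 𝒱ₖ) (Pₖ x̂ₖ' - Pₖ' (x - x̂ₖ))
  + θ ∑ₖ exp(θ 𝒱ₖ) (‖y - C x̂ₖ‖²_{Qₖ⁻¹} - 2 ⟨x - x̂ₖ, Pₖ x̂ₖ'⟩ + ⟨x - x̂ₖ, Pₖ' (x - x̂ₖ)⟩)
      Pₖ (x - x̂ₖ)`. -/
noncomputable def vecV (θ : ℝ) (y : ℝ → Fin r → ℝ) (t : ℝ) (x : Fin n → ℝ) : Fin n → ℝ :=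
  - ∑ k, Real.exp (θ * S.energy y k t x) •
      (S.precision k t *ᵥ S.kalmanDeriv y k t
        - S.precisionDeriv k t *ᵥ (x - S.kalman y k t))
  + θ • ∑ k, (Real.exp (θ * S.energy y k t x) *
      (wnormSq (S.Q k)⁻¹ (y t - S.C *ᵥ S.kalman y k t)
        - 2 * ((x - S.kalman y k t) ⬝ᵥ (S.precision k t *ᵥ S.kalmanDeriv y k t))
        + (x - S.kalman y k t) ⬝ᵥ (S.precisionDeriv k t *ᵥ (x - S.kalman y k t)))) •
      (S.precision k t *ᵥ (x - S.kalman y k t))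

/-- `- M(t, x̂_θ(t))⁻¹ V(t, x̂_θ(t))`. -/
noncomputable def estimatorDeriv (θ : ℝ) (y : ℝ → Fin r → ℝ) (t : ℝ) : Fin n → ℝ :=
  -((S.matM θ y t (S.estimator θ y t))⁻¹ *ᵥ S.vecV θ y t (S.estimator θ y t))

end UncertainSystem

/-- `g` is a weak derivative of `u` on the interval `(0, T)`. -/
def HasWeakDeriv {d : ℕ} (T : ℝ) (u g : ℝ → Fin d → ℝ) : Prop :=
  LocallyIntegrableOn u (Ioo 0 T) ∧ LocallyIntegrableOn g (Ioo 0 T) ∧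
    ∀ φ : ℝ → ℝ, ContDiff ℝ ∞ φ → HasCompactSupport φ → tsupport φ ⊆ Ioo 0 T →
      ∫ t in Ioo 0 T, deriv φ t • u t = -∫ t in Ioo 0 T, φ t • g t

/-- `u ∈ W^{1,p}(0, T; ℝᵈ)`. -/
def MemW1p {d : ℕ} (T : ℝ) (p : ℝ≥0∞) (u : ℝ → Fin d → ℝ) : Prop :=
  MemLp u p (volume.restrict (Ioo 0 T)) ∧
    ∃ g : ℝ → Fin d → ℝ, MemLp g p (volume.restrict (Ioo 0 T)) ∧ HasWeakDeriv T u g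

/-!
The Riccati equation is linearized by the Hamiltonian system `X' = -Aᵀ X + G Y`, `Y' = W X + A Y`:
`Π = Y X⁻¹` exists and stays positive definite because `Xᵀ Y` is nondecreasing. The filters solve
linear equations and are therefore absolutely continuous, and so is the curve `q` of all parameters
`(P_k, x̂_k, r_k)`, where `r_k` is the integral in `𝒱_k`; it is `C¹` if `y` is continuous.

For fixed parameters the estimator is the unique zero of the gradient of `∑ exp (θ 𝒱_k)`, whose
Jacobian is, up to a factor, the positive definite matrix `M`. By the implicit function theorem the
estimator is a smooth, hence locally Lipschitz, function of the parameters. Composed with `q` it is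
absolutely continuous, respectively `C¹`, and differentiating the vanishing of the gradient along
`q` gives `M ẋ + V = 0`. The derivative is bounded by a constant times `‖q'‖`, and `q'` is in `L^p`
since the only term quadratic in `y ∈ L^{2p}` is `r_k' = ‖y - C x̂_k‖²`.
-/

section MatrixCalculus

open scoped Matrix.Norms.Operator

section Entrywise

variable {l n : Type*} [Finite l] [Finite n]

theorem hasDerivWithinAt_matrix_iff {M : ℝ → Matrix l n ℝ} {M' : Matrix l n ℝ} {s : Set ℝ}
    {t : ℝ} : HasDerivWithinAt M M' s t ↔
      ∀ i j, HasDerivWithinAt (fun u => M u i j) (M' i j) s t := by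
  cases nonempty_fintype l
  cases nonempty_fintype n
  exact (hasDerivWithinAt_pi (E' := fun _ : l => n → ℝ)).trans <|
    forall_congr' fun _ => hasDerivWithinAt_pi

theorem hasDerivWithinAt_matrix_transpose {M : ℝ → Matrix l n ℝ} {M' : Matrix l n ℝ} {s : Set ℝ}
    {t : ℝ} (h : HasDerivWithinAt M M' s t) : HasDerivWithinAt (fun u => (M u)ᵀ) M'ᵀ s t :=
  hasDerivWithinAt_matrix_iff.2 fun i j => hasDerivWithinAt_matrix_iff.1 h j i

theorem hasDerivAt_matrix_transpose {M : ℝ → Matrix l n ℝ} {M' : Matrix l n ℝ} {t : ℝ}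
    (h : HasDerivAt M M' t) : HasDerivAt (fun u => (M u)ᵀ) M'ᵀ t := by
  cases nonempty_fintype l
  cases nonempty_fintype n
  exact hasDerivWithinAt_univ.1 (hasDerivWithinAt_matrix_transpose h.hasDerivWithinAt)

end Entrywise

theorem hasDerivWithinAt_matrix_inv {n : Type*} [Fintype n] [DecidableEq n]
    {M : ℝ → Matrix n n ℝ} {M' : Matrix n n ℝ} {s : Set ℝ} {t : ℝ}
    (h : HasDerivWithinAt M M' s t) (hM : IsUnit (M t)) :
    HasDerivWithinAt (fun u => (M u)⁻¹) (-((M t)⁻¹ * M' * (M t)⁻¹)) s t := by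
  obtain ⟨u, hu⟩ := hM
  have h_inv := hasFDerivAt_ringInverse (𝕜 := ℝ) u
  rw [coe_units_inv, hu] at h_inv
  rw [funext fun u => nonsing_inv_eq_ringInverse (M u)]
  exact h_inv.comp_hasDerivWithinAt t h

section Bilinear

variable {l n : Type*} [Fintype n]

/-- The product of a matrix and a vector, as a continuous bilinear map. -/
noncomputable def mulVecCLM (l n : Type*) [Fintype l] [Fintype n] :
    Matrix l n ℝ →L[ℝ] (n → ℝ) →L[ℝ] l → ℝ :=
  (mulVecBilin ℝ ℝ).toContinuousBilinearMap

/-- The dot product of vectors, as a continuous bilinear map. -/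
noncomputable def dotProductCLM (n : Type*) [Fintype n] : (n → ℝ) →L[ℝ] (n → ℝ) →L[ℝ] ℝ :=
  (dotProductBilin ℝ ℝ).toContinuousBilinearMap

theorem hasDerivWithinAt_mulVec [Finite l] {M : ℝ → Matrix l n ℝ} {M' : Matrix l n ℝ}
    {v : ℝ → n → ℝ} {v' : n → ℝ} {s : Set ℝ} {t : ℝ} (hM : HasDerivWithinAt M M' s t)
    (hv : HasDerivWithinAt v v' s t) :
    HasDerivWithinAt (fun u => M u *ᵥ v u) (M t *ᵥ v' + M' *ᵥ v t) s t := by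
  cases nonempty_fintype l
  exact (mulVecCLM l n).hasDerivWithinAt_of_bilinear hM hv

theorem hasDerivWithinAt_dotProduct {v w : ℝ → n → ℝ} {v' w' : n → ℝ} {s : Set ℝ} {t : ℝ}
    (hv : HasDerivWithinAt v v' s t) (hw : HasDerivWithinAt w w' s t) :
    HasDerivWithinAt (fun u => v u ⬝ᵥ w u) (v t ⬝ᵥ w' + v' ⬝ᵥ w t) s t :=
  (dotProductCLM n).hasDerivWithinAt_of_bilinear hv hw

end Bilinear

theorem posSemidef_sub_of_hasDerivAt {n : Type*} [Finite n] {M M' : ℝ → Matrix n n ℝ}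
    (hM : ∀ t, HasDerivAt M (M' t) t) (hM' : ∀ t, (M' t).PosSemidef) {a b : ℝ} (hab : a ≤ b) :
    (M b - M a).PosSemidef := by
  cases nonempty_fintype n
  refine PosSemidef.of_dotProduct_mulVec_nonneg ?_ fun v => ?_
  · have h_antisymm (t : ℝ) : HasDerivAt (fun u => M u - (M u)ᵀ) 0 t := by
      have h_symm : (M' t)ᵀ = M' t := (hM' t).isHermitian
      rw [← sub_self (M' t)]
      nth_rw 2 [← h_symm]
      exact (hM t).sub (hasDerivAt_matrix_transpose (hM t))
    have h_const := is_const_of_deriv_eq_zero (fun t => (h_antisymm t).differentiableAt)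
      (fun t => (h_antisymm t).deriv) a b
    rw [IsHermitian, conjTranspose_eq_transpose_of_trivial, transpose_sub]
    exact (sub_eq_sub_iff_sub_eq_sub.1 h_const.symm).symm
  · have h_form (t : ℝ) : HasDerivAt (fun u => v ⬝ᵥ (M u *ᵥ v)) (v ⬝ᵥ (M' t *ᵥ v)) t :=
      ((dotProductCLM n v).comp ((mulVecCLM n n).flip v)).hasFDerivAt.comp_hasDerivAt t (hM t)
    have h_mono : Monotone fun u => v ⬝ᵥ (M u *ᵥ v) :=
      monotone_of_hasDerivAt_nonneg h_form fun t => (hM' t).dotProduct_mulVec_nonneg v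
    simpa only [star_trivial, sub_mulVec, dotProduct_sub, sub_nonneg] using h_mono hab

end MatrixCalculus

section Riccati

open scoped Matrix.Norms.Operator

theorem exists_hasDerivAt_continuousLinearMap {E : Type*} [NormedAddCommGroup E]
    [NormedSpace ℝ E] [CompleteSpace E] (L : E →L[ℝ] E) (z₀ : E) :
    ∃ Z : ℝ → E, Z 0 = z₀ ∧ ∀ t, HasDerivAt Z (L (Z t)) t :=
  ⟨fun t => NormedSpace.exp (t • L) z₀, by simp, fun t =>
    (ContinuousLinearMap.apply ℝ E z₀).hasFDerivAt.comp_hasDerivAt t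
      (hasDerivAt_exp_smul_const' (𝕂 := ℝ) L t)⟩

variable {n : Type*} [Fintype n] {A G W Γ : Matrix n n ℝ}

/-- The vector field `M ↦ A M + M Aᵀ - M G M + W` of a matrix Riccati equation. -/
def riccatiField (A G W M : Matrix n n ℝ) : Matrix n n ℝ := A * M + M * Aᵀ - M * G * M + W

variable [DecidableEq n]

/-- `(X, Y)` solves the linear Hamiltonian system `X' = -Aᵀ X + G Y`, `Y' = W X + A Y` with
`X(0) = 1`, `Y(0) = Γ`, which linearizes the Riccati equation: `Y X⁻¹` solves the latter. -/
structure IsHamiltonianFlow (A G W Γ : Matrix n n ℝ) (X Y : ℝ → Matrix n n ℝ) : Prop where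
  left_zero : X 0 = 1
  right_zero : Y 0 = Γ
  hasDerivAt_left : ∀ t, HasDerivAt X (-Aᵀ * X t + G * Y t) t
  hasDerivAt_right : ∀ t, HasDerivAt Y (W * X t + A * Y t) t

theorem exists_isHamiltonianFlow (A G W Γ : Matrix n n ℝ) :
    ∃ X Y : ℝ → Matrix n n ℝ, IsHamiltonianFlow A G W Γ X Y := by
  let X := ContinuousLinearMap.fst ℝ (Matrix n n ℝ) (Matrix n n ℝ)
  let Y := ContinuousLinearMap.snd ℝ (Matrix n n ℝ) (Matrix n n ℝ)
  let mulLeft := ContinuousLinearMap.mul ℝ (Matrix n n ℝ)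
  let L := (mulLeft (-Aᵀ) ∘L X + mulLeft G ∘L Y).prod (mulLeft W ∘L X + mulLeft A ∘L Y)
  have : CompleteSpace (Matrix n n ℝ × Matrix n n ℝ) := FiniteDimensional.complete ℝ _
  obtain ⟨Z, hZ₀, hZ⟩ := exists_hasDerivAt_continuousLinearMap L (1, Γ)
  exact ⟨fun t => (Z t).1, fun t => (Z t).2, congrArg Prod.fst hZ₀, congrArg Prod.snd hZ₀,
    fun t => X.hasFDerivAt.comp_hasDerivAt t (hZ t),
    fun t => Y.hasFDerivAt.comp_hasDerivAt t (hZ t)⟩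

namespace IsHamiltonianFlow

variable {X Y : ℝ → Matrix n n ℝ}

theorem hasDerivAt_transpose_mul (h : IsHamiltonianFlow A G W Γ X Y) (hG : Gᵀ = G) (t : ℝ) :
    HasDerivAt (fun u => (X u)ᵀ * Y u) ((Y t)ᵀ * G * Y t + (X t)ᵀ * W * X t) t := by
  convert! (hasDerivAt_matrix_transpose (h.hasDerivAt_left t)).mul (h.hasDerivAt_right t) using 1
  simp only [transpose_add, transpose_mul, transpose_neg, transpose_transpose, hG]
  noncomm_ring

theorem posDef_transpose_mul (h : IsHamiltonianFlow A G W Γ X Y) (hG : G.PosSemidef)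
    (hW : W.PosSemidef) (hΓ : Γ.PosDef) {t : ℝ} (ht : 0 ≤ t) : ((X t)ᵀ * Y t).PosDef := by
  have h_mono := posSemidef_sub_of_hasDerivAt (h.hasDerivAt_transpose_mul hG.isHermitian)
    (fun t => (hG.conjTranspose_mul_mul_same (Y t)).add (hW.conjTranspose_mul_mul_same (X t))) ht
  rw [h.left_zero, h.right_zero, transpose_one, one_mul] at h_mono
  simpa only [add_sub_cancel] using hΓ.add_posSemidef h_mono

theorem isUnit_det (h : IsHamiltonianFlow A G W Γ X Y) (hG : G.PosSemidef)
    (hW : W.PosSemidef) (hΓ : Γ.PosDef) {t : ℝ} (ht : 0 ≤ t) : IsUnit (X t).det := by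
  have h_unit := (isUnit_iff_isUnit_det _).1 (h.posDef_transpose_mul hG hW hΓ ht).isUnit
  rw [det_mul, det_transpose] at h_unit
  exact isUnit_of_mul_isUnit_left h_unit

theorem hasDerivWithinAt_mul_inv (h : IsHamiltonianFlow A G W Γ X Y) {s : Set ℝ} {t : ℝ}
    (hX : IsUnit (X t).det) : HasDerivWithinAt (fun u => Y u * (X u)⁻¹)
      (riccatiField A G W (Y t * (X t)⁻¹)) s t := by
  have hXX : X t * (X t)⁻¹ = 1 := mul_nonsing_inv _ hX
  convert! (h.hasDerivAt_right t).hasDerivWithinAt.mul (hasDerivWithinAt_matrix_inv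
    (h.hasDerivAt_left t).hasDerivWithinAt ((isUnit_iff_isUnit_det _).2 hX)) using 1
  simp only [riccatiField, Matrix.mul_assoc, Matrix.mul_neg, Matrix.neg_mul, Matrix.mul_add,
    Matrix.add_mul, hXX, Matrix.mul_one]
  abel

theorem eq_mul_of_riccati (h : IsHamiltonianFlow A G W Γ X Y) {P : ℝ → Matrix n n ℝ} {T : ℝ}
    (hP₀ : P 0 = Γ)
    (hP : ∀ t ∈ Icc 0 T, HasDerivWithinAt P (riccatiField A G W (P t)) (Icc 0 T) t) :
    ∀ t ∈ Icc 0 T, Y t = P t * X t := by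
  let E (t : ℝ) := Y t - P t * X t
  have hE : ∀ t ∈ Icc 0 T, HasDerivWithinAt E ((A - P t * G) * E t) (Icc 0 T) t := by
    intro t ht
    convert! (h.hasDerivAt_right t).hasDerivWithinAt.sub
      ((hP t ht).mul (h.hasDerivAt_left t).hasDerivWithinAt) using 1
    simp only [E, riccatiField]
    noncomm_ring
  have hP_cont : ContinuousOn P (Icc 0 T) := fun t ht => (hP t ht).continuousWithinAt
  obtain ⟨K, hK⟩ := isCompact_Icc.exists_bound_of_continuousOn
    (continuousOn_const.sub (hP_cont.mul continuousOn_const) :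
      ContinuousOn (fun t => A - P t * G) (Icc 0 T))
  refine fun t ht => sub_eq_zero.1 (eq_zero_of_abs_deriv_le_mul_abs_self_of_eq_zero_right
    (f := E) (f' := fun t => (A - P t * G) * E t) (K := K)
    (fun t ht => (hE t ht).continuousWithinAt) (fun t ht => ?_) ?_ (fun t ht => ?_) t ht)
  · exact (hE t (Ico_subset_Icc_self ht)).mono_of_mem_nhdsWithin (Icc_mem_nhdsGE_of_mem ht)
  · simp only [E, h.left_zero, h.right_zero, hP₀, mul_one, sub_self]
  · exact (norm_mul_le _ _).trans
      (mul_le_mul_of_nonneg_right (hK t (Ico_subset_Icc_self ht)) (norm_nonneg _))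

theorem posDef_of_mul_eq (h : IsHamiltonianFlow A G W Γ X Y) (hG : G.PosSemidef)
    (hW : W.PosSemidef) (hΓ : Γ.PosDef) {t : ℝ} (ht : 0 ≤ t) {P : Matrix n n ℝ}
    (hP : Y t = P * X t) : P.PosDef := by
  have h_posDef := h.posDef_transpose_mul hG hW hΓ ht
  rw [hP, ← mul_assoc] at h_posDef
  exact (IsUnit.posDef_star_left_conjugate_iff
    ((isUnit_iff_isUnit_det _).2 (h.isUnit_det hG hW hΓ ht))).1 h_posDef

end IsHamiltonianFlow

end Riccati

/-- `u` is absolutely continuous on the interval between `a` and `b` with derivative `u'`, in the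
form `u(t) = u(a) + ∫ₐᵗ u'` with `u'` integrable, which makes sense in any normed space. -/
structure IsPrimitiveOnInterval {E : Type*} [NormedAddCommGroup E] [NormedSpace ℝ E]
    (u u' : ℝ → E) (a b : ℝ) : Prop where
  intervalIntegrable : IntervalIntegrable u' volume a b
  eq_add_integral : ∀ t ∈ uIcc a b, u t = u a + ∫ s in a..t, u' s

theorem absolutelyContinuousOnInterval_of_dist_le {X Y : Type*} [PseudoMetricSpace X]
    [PseudoMetricSpace Y] {u : ℝ → X} {v : ℝ → Y} {a b K : ℝ}
    (hu : AbsolutelyContinuousOnInterval u a b)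
    (hv : ∀ s ∈ uIcc a b, ∀ t ∈ uIcc a b, dist (v s) (v t) ≤ K * dist (u s) (u t)) :
    AbsolutelyContinuousOnInterval v a b := by
  have h_majorant : Filter.Tendsto (fun E : ℕ × (ℕ → ℝ × ℝ) =>
      K * ∑ i ∈ Finset.range E.1, dist (u (E.2 i).1) (u (E.2 i).2))
      (AbsolutelyContinuousOnInterval.totalLengthFilter ⊓
        Filter.principal (AbsolutelyContinuousOnInterval.disjWithin a b)) (nhds 0) := by
    simpa only [mul_zero] using Filter.Tendsto.const_mul K hu
  refine squeeze_zero' (.of_forall fun E => Finset.sum_nonneg fun _ _ => dist_nonneg) ?_ h_majorant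
  filter_upwards [Filter.mem_inf_of_right (Filter.mem_principal_self _)] with E hE
  rw [Finset.mul_sum]
  exact Finset.sum_le_sum fun i hi => hv _ (hE.1 i hi).1 _ (hE.1 i hi).2

theorem norm_le_mul_norm_of_dist_le {E F : Type*} [NormedAddCommGroup E] [NormedSpace ℝ E]
    [NormedAddCommGroup F] [NormedSpace ℝ F] {u : ℝ → E} {v : ℝ → F} {u' : E} {v' : F} {K t : ℝ}
    (hu : HasDerivAt u u' t) (hv : HasDerivAt v v' t)
    (hK : ∀ᶠ s in nhds t, dist (v s) (v t) ≤ K * dist (u s) (u t)) : ‖v'‖ ≤ K * ‖u'‖ := by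
  refine le_of_tendsto_of_tendsto hv.tendsto_slope.norm (hu.tendsto_slope.norm.const_mul K) ?_
  filter_upwards [nhdsWithin_le_nhds hK] with s hs
  rw [slope_def_module, slope_def_module, norm_smul, norm_smul, mul_left_comm, ← dist_eq_norm,
    ← dist_eq_norm]
  exact mul_le_mul_of_nonneg_left hs (norm_nonneg _)

theorem ae_restrict_eq_deriv {E : Type*} [NormedAddCommGroup E] [NormedSpace ℝ E]
    {u u' : ℝ → E} {a b : ℝ} (h : ∀ᵐ t, t ∈ Ioo a b → HasDerivAt u (u' t) t) :
    deriv u =ᵐ[volume.restrict (Ioo a b)] u' := by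
  rw [Filter.EventuallyEq, ae_restrict_iff' measurableSet_Ioo]
  exact h.mono fun t ht hmem => (ht hmem).deriv

theorem isPrimitiveOnInterval_of_absolutelyContinuous {u u' : ℝ → ℝ} {a b : ℝ} (hab : a ≤ b)
    (hu : AbsolutelyContinuousOnInterval u a b)
    (hu' : ∀ᵐ t, t ∈ Ioo a b → HasDerivAt u (u' t) t) : IsPrimitiveOnInterval u u' a b where
  intervalIntegrable := by
    have h := hu.intervalIntegrable_deriv
    rw [intervalIntegrable_iff_integrableOn_Ioo_of_le hab] at h ⊢
    exact h.congr (ae_restrict_eq_deriv hu')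
  eq_add_integral t ht := by
    have hat : Ioo a t ⊆ Ioo a b := Ioo_subset_Ioo_right (uIcc_of_le hab ▸ ht).2
    have h_eq : ∫ s in a..t, deriv u s = ∫ s in a..t, u' s := by
      rw [intervalIntegral.integral_of_le (uIcc_of_le hab ▸ ht).1,
        intervalIntegral.integral_of_le (uIcc_of_le hab ▸ ht).1, integral_Ioc_eq_integral_Ioo,
        integral_Ioc_eq_integral_Ioo]
      exact integral_congr_ae (ae_restrict_eq_deriv (hu'.mono fun s hs h => hs (hat h)))
    have h_ftc := (hu.mono (uIcc_subset_uIcc_left ht)).integral_deriv_eq_sub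
    rw [← h_eq, h_ftc, add_sub_cancel]

theorem hasDerivWithinAt_integral_Icc {E : Type*} [NormedAddCommGroup E] [NormedSpace ℝ E]
    [CompleteSpace E] {f : ℝ → E} {a b t : ℝ} (hf : ContinuousOn f (Icc a b))
    (ht : t ∈ Icc a b) : HasDerivWithinAt (fun u => ∫ s in a..u, f s) (f t) (Icc a b) t := by
  have : Fact (t ∈ Icc a b) := ⟨ht⟩
  refine intervalIntegral.integral_hasDerivWithinAt_right ?_
    (hf.stronglyMeasurableAtFilter_nhdsWithin measurableSet_Icc t) (hf t ht)
  exact (hf.mono (Icc_subset_Icc_right ht.2)).intervalIntegrable_of_Icc ht.1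

namespace IsPrimitiveOnInterval

variable {E F : Type*} [NormedAddCommGroup E] [NormedSpace ℝ E] [NormedAddCommGroup F]
  [NormedSpace ℝ F] {u u' : ℝ → E} {v v' : ℝ → F} {a b : ℝ}

theorem continuousOn (h : IsPrimitiveOnInterval u u' a b) : ContinuousOn u (uIcc a b) :=
  (continuousOn_const.add (intervalIntegral.continuousOn_primitive_interval'
    h.intervalIntegrable left_mem_uIcc)).congr h.eq_add_integral

theorem dist_le (h : IsPrimitiveOnInterval u u' a b) {s t : ℝ} (hs : s ∈ uIcc a b)
    (ht : t ∈ uIcc a b) :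
    dist (u s) (u t) ≤ dist (∫ r in a..s, ‖u' r‖) (∫ r in a..t, ‖u' r‖) := by
  have h_int {r : ℝ} (hr : r ∈ uIcc a b) : IntervalIntegrable u' volume a r :=
    h.intervalIntegrable.mono_set (uIcc_subset_uIcc_left hr)
  rw [dist_eq_norm, dist_eq_norm, h.eq_add_integral s hs, h.eq_add_integral t ht,
    add_sub_add_left_eq_sub, intervalIntegral.integral_interval_sub_left (h_int hs) (h_int ht),
    intervalIntegral.integral_interval_sub_left (h_int hs).norm (h_int ht).norm, Real.norm_eq_abs]
  exact intervalIntegral.norm_integral_le_abs_integral_norm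

theorem absolutelyContinuousOnInterval (h : IsPrimitiveOnInterval u u' a b) :
    AbsolutelyContinuousOnInterval u a b :=
  absolutelyContinuousOnInterval_of_dist_le (K := 1)
    (h.intervalIntegrable.norm.absolutelyContinuousOnInterval_intervalIntegral left_mem_uIcc)
    fun s hs t ht => by simpa only [one_mul] using h.dist_le hs ht

theorem add {w w' : ℝ → E} (hu : IsPrimitiveOnInterval u u' a b)
    (hw : IsPrimitiveOnInterval w w' a b) :
    IsPrimitiveOnInterval (fun t => u t + w t) (fun t => u' t + w' t) a b where
  intervalIntegrable := hu.intervalIntegrable.add hw.intervalIntegrable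
  eq_add_integral t ht := by
    rw [hu.eq_add_integral t ht, hw.eq_add_integral t ht, intervalIntegral.integral_add
      (hu.intervalIntegrable.mono_set (uIcc_subset_uIcc_left ht))
      (hw.intervalIntegrable.mono_set (uIcc_subset_uIcc_left ht))]
    abel

theorem pi {κ : Type*} [Fintype κ] [CompleteSpace E] {u u' : ℝ → κ → E}
    (h : ∀ i, IsPrimitiveOnInterval (fun t => u t i) (fun t => u' t i) a b) :
    IsPrimitiveOnInterval u u' a b := by
  have h_int : IntervalIntegrable u' volume a b :=
    ⟨.of_eval fun i => (h i).intervalIntegrable.1, .of_eval fun i => (h i).intervalIntegrable.2⟩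
  refine ⟨h_int, fun t ht => funext fun i => ?_⟩
  rw [(h i).eq_add_integral t ht, Pi.add_apply]
  exact congrArg _ ((ContinuousLinearMap.proj (R := ℝ) (φ := fun _ : κ => E)
    i).intervalIntegral_comp_comm (h_int.mono_set (uIcc_subset_uIcc_left ht)))

theorem of_dist_le {d : ℕ} {w w' : ℝ → Fin d → ℝ} {K : ℝ} (hab : a ≤ b)
    (hu : IsPrimitiveOnInterval u u' a b)
    (hw : ∀ s ∈ uIcc a b, ∀ t ∈ uIcc a b, dist (w s) (w t) ≤ K * dist (u s) (u t))
    (hw' : ∀ᵐ t, t ∈ Ioo a b → HasDerivAt w (w' t) t) : IsPrimitiveOnInterval w w' a b :=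
  .pi fun i => isPrimitiveOnInterval_of_absolutelyContinuous hab
    (absolutelyContinuousOnInterval_of_dist_le hu.absolutelyContinuousOnInterval
      fun s hs t ht => (dist_le_pi_dist _ _ i).trans (hw s hs t ht))
    (hw'.mono fun _ ht hmem => hasDerivAt_pi.1 (ht hmem) i)

variable [CompleteSpace E]

theorem ae_hasDerivAt (h : IsPrimitiveOnInterval u u' a b) :
    ∀ᵐ t, t ∈ Ioo a b → HasDerivAt u (u' t) t := by
  filter_upwards [h.intervalIntegrable.ae_hasDerivAt_integral] with t ht hmem
  have h_mem : uIcc a b ∈ nhds t :=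
    Filter.mem_of_superset (Icc_mem_nhds hmem.1 hmem.2) Icc_subset_uIcc
  exact ((ht (mem_of_mem_nhds h_mem) a left_mem_uIcc).const_add (u a)).congr_of_eventuallyEq
    (Filter.mem_of_superset h_mem h.eq_add_integral)

theorem hasDerivWithinAt (hab : a ≤ b) (h : IsPrimitiveOnInterval u u' a b)
    (hu' : ContinuousOn u' (Icc a b)) {t : ℝ} (ht : t ∈ Icc a b) :
    HasDerivWithinAt u (u' t) (Icc a b) t :=
  ((hasDerivWithinAt_integral_Icc hu' ht).const_add (u a)).congr_of_mem
    (fun s hs => h.eq_add_integral s (uIcc_of_le hab ▸ hs)) ht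

theorem of_hasDerivWithinAt (hab : a ≤ b)
    (hu : ∀ t ∈ Icc a b, HasDerivWithinAt u (u' t) (Icc a b) t)
    (hu' : ContinuousOn u' (Icc a b)) : IsPrimitiveOnInterval u u' a b where
  intervalIntegrable := hu'.intervalIntegrable_of_Icc hab
  eq_add_integral t ht := by
    rw [uIcc_of_le hab] at ht
    have h_sub : Icc a t ⊆ Icc a b := Icc_subset_Icc_right ht.2
    rw [intervalIntegral.integral_eq_sub_of_hasDerivAt_of_le ht.1
      (fun s hs => (hu s (h_sub hs)).continuousWithinAt.mono h_sub)
      (fun s hs => (hu s (h_sub (Ioo_subset_Icc_self hs))).hasDerivAt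
        (Icc_mem_nhds hs.1 (hs.2.trans_le ht.2)))
      ((hu'.mono h_sub).intervalIntegrable_of_Icc ht.1), add_sub_cancel]

variable [CompleteSpace F]

theorem clm_comp (L : E →L[ℝ] F) (h : IsPrimitiveOnInterval u u' a b) :
    IsPrimitiveOnInterval (fun t => L (u t)) (fun t => L (u' t)) a b where
  intervalIntegrable := ⟨L.integrable_comp h.intervalIntegrable.1,
    L.integrable_comp h.intervalIntegrable.2⟩
  eq_add_integral t ht := by
    rw [h.eq_add_integral t ht, map_add, L.intervalIntegral_comp_comm
      (h.intervalIntegrable.mono_set (uIcc_subset_uIcc_left ht))]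

theorem prodMk (hu : IsPrimitiveOnInterval u u' a b) (hv : IsPrimitiveOnInterval v v' a b) :
    IsPrimitiveOnInterval (fun t => (u t, v t)) (fun t => (u' t, v' t)) a b := by
  have h_int : IntervalIntegrable (fun t => (u' t, v' t)) volume a b :=
    ⟨hu.intervalIntegrable.1.prodMk hv.intervalIntegrable.1,
      hu.intervalIntegrable.2.prodMk hv.intervalIntegrable.2⟩
  refine ⟨h_int, fun t ht => ?_⟩
  have h_int_t := h_int.mono_set (uIcc_subset_uIcc_left ht)
  refine Prod.ext ?_ ?_
  · exact (hu.eq_add_integral t ht).trans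
      (congrArg _ ((ContinuousLinearMap.fst ℝ E F).intervalIntegral_comp_comm h_int_t))
  · exact (hv.eq_add_integral t ht).trans
      (congrArg _ ((ContinuousLinearMap.snd ℝ E F).intervalIntegral_comp_comm h_int_t))

theorem integral_deriv_mul_eq_neg {w w' φ : ℝ → ℝ} (hab : a ≤ b)
    (hw : IsPrimitiveOnInterval w w' a b) (hφ : ContDiff ℝ 1 φ) (hsupp : tsupport φ ⊆ Ioo a b) :
    ∫ t in Ioo a b, deriv φ t * w t = -∫ t in Ioo a b, φ t * w' t := by
  have hφa : φ a = 0 := image_eq_zero_of_notMem_tsupport fun h => (lt_irrefl _ (hsupp h).1)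
  have hφb : φ b = 0 := image_eq_zero_of_notMem_tsupport fun h => (lt_irrefl _ (hsupp h).2)
  have h_parts := hφ.contDiffOn.absolutelyContinuousOnInterval.integral_mul_deriv_eq_deriv_mul
    hw.absolutelyContinuousOnInterval
  have h_deriv : ∫ t in Ioo a b, φ t * deriv w t = ∫ t in Ioo a b, φ t * w' t :=
    integral_congr_ae ((ae_restrict_eq_deriv hw.ae_hasDerivAt).mono fun t ht => by simp only [ht])
  rw [hφa, hφb, intervalIntegral.integral_of_le hab, intervalIntegral.integral_of_le hab,
    integral_Ioc_eq_integral_Ioo, integral_Ioc_eq_integral_Ioo, h_deriv] at h_parts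
  rw [h_parts]
  ring

theorem hasWeakDeriv {d : ℕ} {T : ℝ} (hT : 0 ≤ T) {w w' : ℝ → Fin d → ℝ}
    (h : IsPrimitiveOnInterval w w' 0 T) : HasWeakDeriv T w w' := by
  have hw : IntervalIntegrable w volume 0 T := h.continuousOn.intervalIntegrable
  have hw' := h.intervalIntegrable
  have h_int {ψ : ℝ → ℝ} {v : ℝ → Fin d → ℝ} (hψ : Continuous ψ)
      (hv : IntervalIntegrable v volume 0 T) (i : Fin d) :
      Integrable (fun t => (ψ t • v t) i) (volume.restrict (Ioo 0 T)) :=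
    ((intervalIntegrable_iff_integrableOn_Ioo_of_le hT).1
      (hv.continuousOn_smul hψ.continuousOn)).eval i
  refine ⟨((intervalIntegrable_iff_integrableOn_Ioo_of_le hT).1 hw).locallyIntegrableOn,
    ((intervalIntegrable_iff_integrableOn_Ioo_of_le hT).1 hw').locallyIntegrableOn,
    fun φ hφ _ hsupp => funext fun i => ?_⟩
  have hφ' : ContDiff ℝ 1 φ := hφ.of_le (by norm_cast)
  rw [Pi.neg_apply, eval_integral (h_int hφ'.continuous_deriv_one hw),
    eval_integral (h_int hφ.continuous hw')]
  exact (h.clm_comp (ContinuousLinearMap.proj (R := ℝ) (φ := fun _ => ℝ)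
    i)).integral_deriv_mul_eq_neg hT hφ' hsupp

end IsPrimitiveOnInterval

theorem memLp_of_continuousOn_Icc {E : Type*} [NormedAddCommGroup E] {f : ℝ → E} {a b : ℝ}
    (hf : ContinuousOn f (Icc a b)) (p : ℝ≥0∞) : MemLp f p (volume.restrict (Ioo a b)) := by
  obtain ⟨K, hK⟩ := isCompact_Icc.exists_bound_of_continuousOn hf
  exact .of_bound ((hf.mono Ioo_subset_Icc_self).aestronglyMeasurable measurableSet_Ioo) K
    (ae_restrict_of_forall_mem measurableSet_Ioo fun t ht => hK t (Ioo_subset_Icc_self ht))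

section FundamentalMatrix

open scoped Matrix.Norms.Operator

section Continuity

variable {l n : Type*} [Fintype n]

theorem continuousOn_mulVec [Finite l] {s : Set ℝ} {M : ℝ → Matrix l n ℝ} {v : ℝ → n → ℝ}
    (hM : ContinuousOn M s) (hv : ContinuousOn v s) :
    ContinuousOn (fun t => M t *ᵥ v t) s := by
  cases nonempty_fintype l
  exact ((mulVecCLM l n).continuous.comp_continuousOn hM).clm_apply hv

theorem memLp_mulVec [Fintype l] {p : ℝ≥0∞} {a b : ℝ} {M : ℝ → Matrix l n ℝ} {v : ℝ → n → ℝ}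
    (hM : ContinuousOn M (Icc a b)) (hv : MemLp v p (volume.restrict (Ioo a b))) :
    MemLp (fun t => M t *ᵥ v t) p (volume.restrict (Ioo a b)) :=
  (mulVecCLM l n).memLp_of_bilin (p := ⊤) p (memLp_of_continuousOn_Icc hM ⊤) hv

end Continuity

variable {n : Type*} [Fintype n] [DecidableEq n] {L Φ : ℝ → Matrix n n ℝ} {T : ℝ}

/-- `Φ` is the fundamental matrix on `[0, T]` of the linear differential equation `z' = L z`. -/
structure IsFundamentalMatrix (L Φ : ℝ → Matrix n n ℝ) (T : ℝ) : Prop where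
  apply_zero : Φ 0 = 1
  isUnit : ∀ t ∈ Icc 0 T, IsUnit (Φ t)
  hasDerivWithinAt : ∀ t ∈ Icc 0 T, HasDerivWithinAt Φ (L t * Φ t) (Icc 0 T) t

namespace IsFundamentalMatrix

theorem continuousOn_inv (h : IsFundamentalMatrix L Φ T) :
    ContinuousOn (fun t => (Φ t)⁻¹) (Icc 0 T) := fun t ht =>
  (hasDerivWithinAt_matrix_inv (h.hasDerivWithinAt t ht) (h.isUnit t ht)).continuousWithinAt

theorem hasDerivWithinAt_variation_of_constants (h : IsFundamentalMatrix L Φ T) {g : ℝ → n → ℝ}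
    (hg : ContinuousOn g (Icc 0 T)) (z₀ : n → ℝ) {t : ℝ} (ht : t ∈ Icc 0 T) :
    HasDerivWithinAt (fun u => Φ u *ᵥ (z₀ + ∫ s in 0..u, (Φ s)⁻¹ *ᵥ g s))
      (L t *ᵥ (Φ t *ᵥ (z₀ + ∫ s in 0..t, (Φ s)⁻¹ *ᵥ g s)) + g t) (Icc 0 T) t := by
  have h_int := hasDerivWithinAt_integral_Icc (continuousOn_mulVec h.continuousOn_inv hg) ht
  convert! hasDerivWithinAt_mulVec (h.hasDerivWithinAt t ht) (h_int.const_add z₀) using 1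
  rw [mulVec_mulVec, mulVec_mulVec,
    mul_nonsing_inv _ ((isUnit_iff_isUnit_det _).1 (h.isUnit t ht)), one_mulVec, add_comm]

theorem exists_isPrimitiveOnInterval (h : IsFundamentalMatrix L Φ T) (hT : 0 ≤ T)
    (hL : ContinuousOn L (Icc 0 T)) {f : ℝ → n → ℝ} (hf : IntervalIntegrable f volume 0 T)
    (x₀ : n → ℝ) :
    ∃ x, x 0 = x₀ ∧ IsPrimitiveOnInterval x (fun t => L t *ᵥ x t + f t) 0 T := by
  let F (t : ℝ) := ∫ s in 0..t, f s
  have hF : IsPrimitiveOnInterval F f 0 T := ⟨hf, fun t _ => by simp [F]⟩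
  have hg : ContinuousOn (fun t => L t *ᵥ F t) (Icc 0 T) :=
    continuousOn_mulVec hL (uIcc_of_le hT ▸ hF.continuousOn)
  -- `x - F` solves a differential equation whose forcing term `L F` is continuous.
  let z (t : ℝ) := Φ t *ᵥ (x₀ + ∫ s in 0..t, (Φ s)⁻¹ *ᵥ (L s *ᵥ F s))
  have hz (t : ℝ) (ht : t ∈ Icc 0 T) := h.hasDerivWithinAt_variation_of_constants hg x₀ ht
  have hz_prim : IsPrimitiveOnInterval z (fun t => L t *ᵥ z t + L t *ᵥ F t) 0 T :=
    .of_hasDerivWithinAt hT hz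
      ((continuousOn_mulVec hL fun t ht => (hz t ht).continuousWithinAt).add hg)
  refine ⟨fun t => z t + F t, by simp [z, F, h.apply_zero], ?_⟩
  simpa only [mulVec_add] using hz_prim.add hF

end IsFundamentalMatrix

theorem IsHamiltonianFlow.isFundamentalMatrix {A G W Γ : Matrix n n ℝ}
    {X Y P : ℝ → Matrix n n ℝ} (h : IsHamiltonianFlow A G W Γ X Y) (hG : Gᵀ = G)
    (hX : ∀ t ∈ Icc 0 T, IsUnit (X t)) (hP : ∀ t ∈ Icc 0 T, (P t)ᵀ = P t)
    (hY : ∀ t ∈ Icc 0 T, Y t = P t * X t) :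
    IsFundamentalMatrix (fun t => A - P t * G) (fun t => ((X t)⁻¹)ᵀ) T where
  apply_zero := by simp [h.left_zero]
  isUnit t ht := (isUnit_transpose _).2 (isUnit_nonsing_inv_iff.2 (hX t ht))
  hasDerivWithinAt t ht := by
    have hX_det := (isUnit_iff_isUnit_det _).1 (hX t ht)
    convert! hasDerivWithinAt_matrix_transpose (hasDerivWithinAt_matrix_inv
      (h.hasDerivAt_left t).hasDerivWithinAt (hX t ht)) using 1
    rw [hY t ht, ← mul_assoc, ← add_mul, ← mul_assoc, mul_assoc _ (X t), mul_nonsing_inv _ hX_det,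
      mul_one, transpose_neg, transpose_mul, transpose_add, transpose_mul, transpose_neg,
      transpose_transpose, hP t ht, hG]
    noncomm_ring

end FundamentalMatrix

namespace UncertainSystem

open scoped Matrix.Norms.Operator

variable {ι : Type*} {n m r : ℕ} (S : UncertainSystem ι n m r)

/-- The quadratic coefficient `Cᵀ Q⁻¹ C` of the Riccati equation of the `k`-th system. -/
noncomputable def outputGram (k : ι) : Matrix (Fin n) (Fin n) ℝ := S.Cᵀ * (S.Q k)⁻¹ * S.C

/-- The constant coefficient `B R Bᵀ` of the Riccati equation of the `k`-th system. -/
def inputGram (k : ι) : Matrix (Fin n) (Fin n) ℝ := S.B * S.R k * S.Bᵀ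

theorem posSemidef_outputGram (k : ι) : (S.outputGram k).PosSemidef :=
  (S.Q_posDef k).inv.posSemidef.conjTranspose_mul_mul_same S.C

theorem posSemidef_inputGram (k : ι) : (S.inputGram k).PosSemidef :=
  (S.R_posDef k).posSemidef.mul_mul_conjTranspose_same S.B

/-- The time derivative of `Π_k`, read off the Riccati equation. -/
noncomputable def covarianceDeriv (k : ι) (t : ℝ) : Matrix (Fin n) (Fin n) ℝ :=
  riccatiField (S.A k) (S.outputGram k) (S.inputGram k) (S.covariance k t)

/-- The matrix `A_k - Π_k Cᵀ Q_k⁻¹ C` of the Kalman filter equation. -/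
noncomputable def closedLoop (k : ι) (t : ℝ) : Matrix (Fin n) (Fin n) ℝ :=
  S.A k - S.covariance k t * S.outputGram k

theorem isRiccatiSolution_iff {k : ι} {Pi : ℝ → Matrix (Fin n) (Fin n) ℝ} :
    S.IsRiccatiSolution k Pi ↔ Pi 0 = S.Γ k ∧ ∀ t ∈ Icc 0 S.T, HasDerivWithinAt Pi
      (riccatiField (S.A k) (S.outputGram k) (S.inputGram k) (Pi t)) (Icc 0 S.T) t := by
  simp only [IsRiccatiSolution, hasDerivWithinAt_matrix_iff, riccatiField, outputGram, inputGram,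
    Matrix.mul_assoc]

theorem exists_isHamiltonianFlow (k : ι) : ∃ X Y : ℝ → Matrix (Fin n) (Fin n) ℝ,
    IsHamiltonianFlow (S.A k) (S.outputGram k) (S.inputGram k) (S.Γ k) X Y ∧
      ∀ t ∈ Icc 0 S.T, IsUnit (X t).det := by
  obtain ⟨X, Y, h⟩ := _root_.exists_isHamiltonianFlow (S.A k) (S.outputGram k) (S.inputGram k)
    (S.Γ k)
  exact ⟨X, Y, h, fun t ht =>
    h.isUnit_det (S.posSemidef_outputGram k) (S.posSemidef_inputGram k) (S.Γ_posDef k) ht.1⟩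

theorem isRiccatiSolution_covariance (k : ι) : S.IsRiccatiSolution k (S.covariance k) := by
  obtain ⟨X, Y, h, hX⟩ := S.exists_isHamiltonianFlow k
  exact Classical.epsilon_spec (p := S.IsRiccatiSolution k) ⟨fun t => Y t * (X t)⁻¹,
    S.isRiccatiSolution_iff.2 ⟨by simp [h.left_zero, h.right_zero],
      fun t ht => h.hasDerivWithinAt_mul_inv (hX t ht)⟩⟩

theorem hasDerivWithinAt_covariance (k : ι) {t : ℝ} (ht : t ∈ Icc 0 S.T) :
    HasDerivWithinAt (S.covariance k) (S.covarianceDeriv k t) (Icc 0 S.T) t :=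
  (S.isRiccatiSolution_iff.1 (S.isRiccatiSolution_covariance k)).2 t ht

theorem continuousOn_covariance (k : ι) : ContinuousOn (S.covariance k) (Icc 0 S.T) :=
  fun _ ht => (S.hasDerivWithinAt_covariance k ht).continuousWithinAt

theorem continuousOn_covarianceDeriv (k : ι) :
    ContinuousOn (S.covarianceDeriv k) (Icc 0 S.T) := by
  have h := S.continuousOn_covariance k
  exact (((continuousOn_const.mul h).add (h.mul continuousOn_const)).sub
    ((h.mul continuousOn_const).mul h)).add continuousOn_const

theorem continuousOn_closedLoop (k : ι) : ContinuousOn (S.closedLoop k) (Icc 0 S.T) :=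
  continuousOn_const.sub ((S.continuousOn_covariance k).mul continuousOn_const)

theorem eq_covariance_mul {k : ι} {X Y : ℝ → Matrix (Fin n) (Fin n) ℝ}
    (h : IsHamiltonianFlow (S.A k) (S.outputGram k) (S.inputGram k) (S.Γ k) X Y) :
    ∀ t ∈ Icc 0 S.T, Y t = S.covariance k t * X t :=
  h.eq_mul_of_riccati (S.isRiccatiSolution_covariance k).1
    fun _ ht => S.hasDerivWithinAt_covariance k ht

theorem posDef_covariance (k : ι) {t : ℝ} (ht : t ∈ Icc 0 S.T) : (S.covariance k t).PosDef := by
  obtain ⟨X, Y, h, -⟩ := S.exists_isHamiltonianFlow k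
  exact h.posDef_of_mul_eq (S.posSemidef_outputGram k) (S.posSemidef_inputGram k)
    (S.Γ_posDef k) ht.1 (S.eq_covariance_mul h t ht)

theorem exists_isFundamentalMatrix_closedLoop (k : ι) :
    ∃ Φ, IsFundamentalMatrix (S.closedLoop k) Φ S.T := by
  obtain ⟨X, Y, h, hX⟩ := S.exists_isHamiltonianFlow k
  exact ⟨_, h.isFundamentalMatrix (S.posSemidef_outputGram k).isHermitian
    (fun t ht => (isUnit_iff_isUnit_det _).2 (hX t ht))
    (fun t ht => (S.posDef_covariance k ht).isHermitian) (S.eq_covariance_mul h)⟩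

theorem posDef_precision (k : ι) {t : ℝ} (ht : t ∈ Icc 0 S.T) : (S.precision k t).PosDef :=
  (S.posDef_covariance k ht).inv

theorem precisionDeriv_eq (k : ι) {t : ℝ} (ht : t ∈ Icc 0 S.T) :
    S.precisionDeriv k t = -(S.precision k t * S.covarianceDeriv k t * S.precision k t) := by
  have h := hasDerivWithinAt_matrix_inv (S.hasDerivWithinAt_covariance k ht)
    (S.posDef_covariance k ht).isUnit
  ext i j
  exact (hasDerivWithinAt_matrix_iff.1 h i j).derivWithin (uniqueDiffOn_Icc S.T_pos t ht)

theorem hasDerivWithinAt_precision (k : ι) {t : ℝ} (ht : t ∈ Icc 0 S.T) :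
    HasDerivWithinAt (S.precision k) (S.precisionDeriv k t) (Icc 0 S.T) t := by
  rw [S.precisionDeriv_eq k ht]
  exact hasDerivWithinAt_matrix_inv (S.hasDerivWithinAt_covariance k ht)
    (S.posDef_covariance k ht).isUnit

theorem continuousOn_precisionDeriv (k : ι) : ContinuousOn (S.precisionDeriv k) (Icc 0 S.T) := by
  have h : ContinuousOn (S.precision k) (Icc 0 S.T) :=
    fun t ht => (S.hasDerivWithinAt_precision k ht).continuousWithinAt
  exact ((h.mul (S.continuousOn_covarianceDeriv k)).mul h).neg.congr
    fun t ht => S.precisionDeriv_eq k ht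

theorem isPrimitiveOnInterval_precision (k : ι) :
    IsPrimitiveOnInterval (S.precision k) (S.precisionDeriv k) 0 S.T :=
  .of_hasDerivWithinAt S.T_pos.le (fun _ ht => S.hasDerivWithinAt_precision k ht)
    (S.continuousOn_precisionDeriv k)

/-- The Kalman gain `Π_k Cᵀ Q_k⁻¹`. -/
noncomputable def gain (k : ι) (t : ℝ) : Matrix (Fin n) (Fin r) ℝ :=
  S.covariance k t * S.Cᵀ * (S.Q k)⁻¹

theorem continuousOn_gain (k : ι) : ContinuousOn (S.gain k) (Icc 0 S.T) :=
  ((continuous_id.matrix_mul continuous_const).matrix_mul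
    continuous_const).comp_continuousOn (S.continuousOn_covariance k)

/-- The innovation `y - C x̂_k` of the Kalman filter. -/
noncomputable def innovation (y : ℝ → Fin r → ℝ) (k : ι) (t : ℝ) : Fin r → ℝ :=
  y t - S.C *ᵥ S.kalman y k t

/-- The right-hand side of the Kalman filter equation. Unlike `kalmanDeriv`, it does not presuppose
that the filter is differentiable at `t`. -/
noncomputable def kalmanRHS (y : ℝ → Fin r → ℝ) (k : ι) (t : ℝ) : Fin n → ℝ :=
  S.A k *ᵥ S.kalman y k t + S.gain k t *ᵥ S.innovation y k t

theorem mulVec_add_gain_mulVec_sub (k : ι) (t : ℝ) (x : Fin n → ℝ) (z : Fin r → ℝ) :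
    S.A k *ᵥ x + S.gain k t *ᵥ (z - S.C *ᵥ x) = S.closedLoop k t *ᵥ x + S.gain k t *ᵥ z := by
  simp only [closedLoop, outputGram, gain, mulVec_sub, sub_mulVec, mulVec_mulVec,
    Matrix.mul_assoc]
  abel

variable {S} {y : ℝ → Fin r → ℝ}

theorem intervalIntegrable_gain_mulVec (hy : IntegrableOn y (Ioo 0 S.T)) (k : ι) :
    IntervalIntegrable (fun t => S.gain k t *ᵥ y t) volume 0 S.T :=
  (intervalIntegrable_iff_integrableOn_Ioo_of_le S.T_pos.le).2 <| memLp_one_iff_integrable.1 <|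
    memLp_mulVec (S.continuousOn_gain k) (memLp_one_iff_integrable.2 hy)

theorem exists_isKalmanFilter (hy : IntegrableOn y (Ioo 0 S.T)) (k : ι) :
    ∃ x, S.IsKalmanFilter y k x := by
  obtain ⟨Φ, hΦ⟩ := S.exists_isFundamentalMatrix_closedLoop k
  obtain ⟨x, hx₀, hx⟩ := hΦ.exists_isPrimitiveOnInterval S.T_pos.le (S.continuousOn_closedLoop k)
    (intervalIntegrable_gain_mulVec hy k) S.x₀
  simp only [← S.mulVec_add_gain_mulVec_sub] at hx
  have h_uIcc : uIcc 0 S.T = Icc 0 S.T := uIcc_of_le S.T_pos.le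
  exact ⟨x, h_uIcc ▸ hx.continuousOn, h_uIcc ▸ hx₀ ▸ hx.eq_add_integral⟩

theorem isKalmanFilter_kalman (hy : IntegrableOn y (Ioo 0 S.T)) (k : ι) :
    S.IsKalmanFilter y k (S.kalman y k) :=
  Classical.epsilon_spec (exists_isKalmanFilter hy k)

theorem memLp_kalman (hy : IntegrableOn y (Ioo 0 S.T)) (k : ι) (p : ℝ≥0∞) :
    MemLp (S.kalman y k) p (volume.restrict (Ioo 0 S.T)) :=
  memLp_of_continuousOn_Icc (isKalmanFilter_kalman hy k).1 p

theorem memLp_kalmanRHS {p : ℝ≥0∞} (hp : 1 ≤ p) (hy : MemLp y p (volume.restrict (Ioo 0 S.T)))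
    (k : ι) : MemLp (S.kalmanRHS y k) p (volume.restrict (Ioo 0 S.T)) := by
  have h_eq : S.kalmanRHS y k =
      fun t => S.closedLoop k t *ᵥ S.kalman y k t + S.gain k t *ᵥ y t :=
    funext fun t => S.mulVec_add_gain_mulVec_sub k t (S.kalman y k t) (y t)
  rw [h_eq]
  exact (memLp_mulVec (S.continuousOn_closedLoop k) (memLp_kalman (hy.integrable hp) k p)).add
    (memLp_mulVec (S.continuousOn_gain k) hy)

theorem isPrimitiveOnInterval_kalman (hy : IntegrableOn y (Ioo 0 S.T)) (k : ι) :
    IsPrimitiveOnInterval (S.kalman y k) (S.kalmanRHS y k) 0 S.T where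
  intervalIntegrable := (intervalIntegrable_iff_integrableOn_Ioo_of_le S.T_pos.le).2 <|
    memLp_one_iff_integrable.1 (memLp_kalmanRHS le_rfl (memLp_one_iff_integrable.2 hy) k)
  eq_add_integral t ht := by
    have h_eq := (isKalmanFilter_kalman hy k).2
    have h_zero : S.kalman y k 0 = S.x₀ := by simpa using h_eq 0 ⟨le_rfl, S.T_pos.le⟩
    rw [h_zero]
    exact h_eq t (uIcc_of_le S.T_pos.le ▸ ht)

theorem kalmanDeriv_eq {k : ι} {t : ℝ} {v : Fin n → ℝ} (ht : t ∈ Icc 0 S.T)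
    (h : HasDerivWithinAt (S.kalman y k) v (Icc 0 S.T) t) : S.kalmanDeriv y k t = v :=
  h.derivWithin (uniqueDiffOn_Icc S.T_pos t ht)

theorem memLp_wnormSq_innovation {p : ℝ≥0∞} (hp : 1 ≤ p)
    (hy : MemLp y (2 * p) (volume.restrict (Ioo 0 S.T))) (k : ι) :
    MemLp (fun t => wnormSq (S.Q k)⁻¹ (S.innovation y k t)) p
      (volume.restrict (Ioo 0 S.T)) := by
  have : ENNReal.HolderTriple (2 * p) (2 * p) p := ⟨by
    rw [ENNReal.mul_inv (.inl two_ne_zero) (.inl ENNReal.ofNat_ne_top), ← add_mul,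
      ENNReal.inv_two_add_inv_two, one_mul]⟩
  have h_int := hy.integrable (hp.trans (le_mul_of_one_le_left' one_le_two))
  have h_innovation : MemLp (S.innovation y k) (2 * p) (volume.restrict (Ioo 0 S.T)) :=
    hy.sub (memLp_mulVec continuousOn_const (memLp_kalman h_int k _))
  exact (dotProductCLM (Fin r)).memLp_of_bilin p h_innovation
    (memLp_mulVec continuousOn_const h_innovation)

end UncertainSystem

section EntropicRisk

open Filter in
open scoped MatrixOrder Matrix.Norms.L2Operator in
theorem tendsto_wnormSq_cocompact_atTop {d : ℕ} {P : Matrix (Fin d) (Fin d) ℝ} (hP : P.PosDef) :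
    Tendsto (wnormSq P) (cocompact (Fin d → ℝ)) atTop := by
  obtain ⟨B, rfl⟩ := CStarAlgebra.nonneg_iff_eq_star_mul_self.1 hP.posSemidef.nonneg
  have hB : Function.Injective B.mulVec :=
    mulVec_injective_of_isUnit (isUnit_of_mul_isUnit_right hP.isUnit)
  let L := (WithLp.linearEquiv 2 ℝ (Fin d → ℝ)).symm.toLinearMap ∘ₗ B.mulVecLin
  have hL : Function.Injective L := (WithLp.linearEquiv 2 ℝ (Fin d → ℝ)).symm.injective.comp hB
  have h_norm (x : Fin d → ℝ) : ‖L x‖ ^ 2 = wnormSq (star B * B) x := by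
    rw [EuclideanSpace.real_norm_sq_eq, wnormSq, ← mulVec_mulVec, dotProduct_mulVec,
      star_eq_conjTranspose, conjTranspose_eq_transpose_of_trivial, vecMul_transpose]
    simp [L, dotProduct, sq]
  rw [← funext h_norm]
  exact (tendsto_pow_atTop two_ne_zero).comp (tendsto_norm_cocompact_atTop.comp
    (LinearMap.isClosedEmbedding_of_injective (LinearMap.ker_eq_bot.2 hL)).tendsto_cocompact)

open scoped Matrix.Norms.Operator

/-- The parameters `(P, ξ, ρ)` of the energy `x ↦ ‖x - ξ‖²_P + ρ` of one system. -/
abbrev EnergyData (d : ℕ) := Matrix (Fin d) (Fin d) ℝ × (Fin d → ℝ) × ℝ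

variable {d : ℕ}

namespace EnergyData

/-- The energy `x ↦ ‖x - ξ‖²_P + ρ` with parameters `(P, ξ, ρ)`. -/
def energy (e : EnergyData d) (x : Fin d → ℝ) : ℝ := wnormSq e.1 (x - e.2.1) + e.2.2

/-- The exponential weight of a point in the entropic risk. -/
noncomputable def weight (θ : ℝ) (e : EnergyData d) (x : Fin d → ℝ) : ℝ :=
  Real.exp (θ * e.energy x)

/-- The gradient of the weight in `x`, divided by `2 θ`. -/
noncomputable def gradient (θ : ℝ) (e : EnergyData d) (x : Fin d → ℝ) : Fin d → ℝ :=
  e.weight θ x • (e.1 *ᵥ (x - e.2.1))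

/-- The Jacobian matrix of `gradient` in `x`. -/
noncomputable def hessian (θ : ℝ) (e : EnergyData d) (x : Fin d → ℝ) : Matrix (Fin d) (Fin d) ℝ :=
  e.weight θ x • (e.1 + (2 * θ) • (e.1 * vecMulVec (x - e.2.1) (x - e.2.1) * e.1))

/-- The derivative of `energy` at `x` in the parameters, in the direction `e'`. -/
def energyRate (e e' : EnergyData d) (x : Fin d → ℝ) : ℝ :=
  e'.2.2 - 2 * ((x - e.2.1) ⬝ᵥ (e.1 *ᵥ e'.2.1)) + (x - e.2.1) ⬝ᵥ (e'.1 *ᵥ (x - e.2.1))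

/-- The derivative of `gradient` at `x` in the parameters, in the direction `e'`. -/
noncomputable def drift (θ : ℝ) (e e' : EnergyData d) (x : Fin d → ℝ) : Fin d → ℝ :=
  -(e.weight θ x • (e.1 *ᵥ e'.2.1 - e'.1 *ᵥ (x - e.2.1))) +
    θ • ((e.weight θ x * e.energyRate e' x) • (e.1 *ᵥ (x - e.2.1)))

theorem weight_pos (θ : ℝ) (e : EnergyData d) (x : Fin d → ℝ) : 0 < e.weight θ x := Real.exp_pos _

section ContDiff

variable {E : Type*} [NormedAddCommGroup E] [NormedSpace ℝ E] {k : ℕ∞ω} {e : E → EnergyData d}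
  {x : E → Fin d → ℝ}

theorem contDiff_mulVec_sub (he : ContDiff ℝ k e) (hx : ContDiff ℝ k x) :
    ContDiff ℝ k fun u => (e u).1 *ᵥ (x u - (e u).2.1) :=
  ((mulVecCLM (Fin d) (Fin d)).contDiff.comp he.fst).clm_apply (hx.sub he.snd.fst)

theorem contDiff_weight (θ : ℝ) (he : ContDiff ℝ k e) (hx : ContDiff ℝ k x) :
    ContDiff ℝ k fun u => (e u).weight θ (x u) :=
  (contDiff_const.mul ((((dotProductCLM (Fin d)).contDiff.comp (hx.sub he.snd.fst)).clm_apply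
    (contDiff_mulVec_sub he hx)).add he.snd.snd)).exp

theorem contDiff_gradient (θ : ℝ) (he : ContDiff ℝ k e) (hx : ContDiff ℝ k x) :
    ContDiff ℝ k fun u => (e u).gradient θ (x u) :=
  (contDiff_weight θ he hx).smul (contDiff_mulVec_sub he hx)

end ContDiff

section Curve

variable {e : ℝ → EnergyData d} {e' : EnergyData d} {x : ℝ → Fin d → ℝ} {x' : Fin d → ℝ}
  {s : Set ℝ} {t : ℝ}

theorem hasDerivWithinAt_mulVec_sub (he : HasDerivWithinAt e e' s t)
    (hx : HasDerivWithinAt x x' s t) :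
    HasDerivWithinAt (fun u => (e u).1 *ᵥ (x u - (e u).2.1))
      ((e t).1 *ᵥ (x' - e'.2.1) + e'.1 *ᵥ (x t - (e t).2.1)) s t :=
  hasDerivWithinAt_mulVec he.fst (hx.sub he.snd.fst)

theorem hasDerivWithinAt_energy (he : HasDerivWithinAt e e' s t) (hx : HasDerivWithinAt x x' s t)
    (h_symm : (e t).1ᵀ = (e t).1) :
    HasDerivWithinAt (fun u => (e u).energy (x u))
      (2 * (((e t).1 *ᵥ (x t - (e t).2.1)) ⬝ᵥ x') + (e t).energyRate e' (x t)) s t := by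
  convert! (hasDerivWithinAt_dotProduct (hx.sub he.snd.fst)
    (hasDerivWithinAt_mulVec_sub he hx)).add he.snd.snd using 1
  have h_comm (v w : Fin d → ℝ) : ((e t).1 *ᵥ v) ⬝ᵥ w = v ⬝ᵥ ((e t).1 *ᵥ w) := by
    rw [dotProduct_mulVec, ← mulVec_transpose, h_symm]
  simp only [energyRate, Pi.sub_apply, dotProduct_comm (x' - e'.2.1), h_comm, mulVec_sub _ x',
    dotProduct_add, dotProduct_sub]
  ring

theorem hasDerivWithinAt_weight (θ : ℝ) (he : HasDerivWithinAt e e' s t)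
    (hx : HasDerivWithinAt x x' s t) (h_symm : (e t).1ᵀ = (e t).1) :
    HasDerivWithinAt (fun u => (e u).weight θ (x u)) (θ * (2 * ((e t).gradient θ (x t) ⬝ᵥ x') +
      (e t).weight θ (x t) * (e t).energyRate e' (x t))) s t := by
  convert! ((hasDerivWithinAt_energy he hx h_symm).const_mul θ).exp using 1
  simp only [gradient, weight, smul_dotProduct, smul_eq_mul]
  ring

theorem hasDerivWithinAt_gradient (θ : ℝ) (he : HasDerivWithinAt e e' s t)
    (hx : HasDerivWithinAt x x' s t) (h_symm : (e t).1ᵀ = (e t).1) :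
    HasDerivWithinAt (fun u => (e u).gradient θ (x u))
      ((e t).hessian θ (x t) *ᵥ x' + (e t).drift θ e' (x t)) s t := by
  convert! (hasDerivWithinAt_weight θ he hx h_symm).smul
    (hasDerivWithinAt_mulVec_sub he hx) using 1
  have h_rankOne : ((e t).1 * vecMulVec (x t - (e t).2.1) (x t - (e t).2.1) * (e t).1) *ᵥ x' =
      (((e t).1 *ᵥ (x t - (e t).2.1)) ⬝ᵥ x') • ((e t).1 *ᵥ (x t - (e t).2.1)) := by
    rw [mul_vecMulVec, vecMulVec_mul, vecMulVec_mulVec, ← mulVec_transpose, h_symm]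
    simp
  simp only [hessian, drift, gradient, smul_mulVec, add_mulVec, h_rankOne, mulVec_sub,
    smul_dotProduct]
  module

end Curve

theorem posDef_hessian {θ : ℝ} (hθ : 0 ≤ θ) {e : EnergyData d} (he : e.1.PosDef)
    (x : Fin d → ℝ) : (e.hessian θ x).PosDef := by
  have h_rankOne : (e.1 * vecMulVec (x - e.2.1) (x - e.2.1) * e.1).PosSemidef := by
    have h := (posSemidef_vecMulVec_self_star (x - e.2.1)).conjTranspose_mul_mul_same e.1
    rwa [he.isHermitian, star_trivial] at h
  exact (he.add_posSemidef (h_rankOne.smul (by positivity))).smul (e.weight_pos θ x)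

theorem energyRate_zero (e : EnergyData d) (x : Fin d → ℝ) : e.energyRate 0 x = 0 := by
  simp [energyRate]

theorem drift_zero (θ : ℝ) (e : EnergyData d) (x : Fin d → ℝ) : e.drift θ 0 x = 0 := by
  simp [drift, energyRate_zero]

end EnergyData

variable {ι : Type*} [Fintype ι] {θ : ℝ}

theorem entropicRisk_le_entropicRisk_iff [Nonempty ι] (hθ : 0 < θ) {X Y : ι → ℝ} :
    entropicRisk θ X ≤ entropicRisk θ Y ↔
      ∑ k, Real.exp (θ * X k) ≤ ∑ k, Real.exp (θ * Y k) := by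
  have h_pos (Z : ι → ℝ) : 0 < ∑ k, Real.exp (θ * Z k) :=
    Finset.sum_pos (fun k _ => Real.exp_pos _) Finset.univ_nonempty
  have h_card : 0 < 1 / (Fintype.card ι : ℝ) := by positivity
  rw [entropicRisk, entropicRisk, mul_le_mul_iff_right₀ (one_div_pos.2 hθ),
    Real.log_le_log_iff (mul_pos h_card (h_pos X)) (mul_pos h_card (h_pos Y)),
    mul_le_mul_iff_right₀ h_card]

/-- The sum of the exponential weights of a point, an increasing function of the entropic risk. -/
noncomputable def totalWeight (θ : ℝ) (q : ι → EnergyData d) (x : Fin d → ℝ) : ℝ :=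
  ∑ k, (q k).weight θ x

/-- The gradient of `totalWeight` in `x`, divided by `2 θ`. -/
noncomputable def riskGradient (θ : ℝ) (q : ι → EnergyData d) (x : Fin d → ℝ) : Fin d → ℝ :=
  ∑ k, (q k).gradient θ x

/-- The Jacobian matrix of `riskGradient` in `x`; the paper's `M`. -/
noncomputable def riskHessian (θ : ℝ) (q : ι → EnergyData d) (x : Fin d → ℝ) :
    Matrix (Fin d) (Fin d) ℝ :=
  ∑ k, (q k).hessian θ x

/-- The derivative of `riskGradient` at `x` in the parameters, in the direction `q'`; the
paper's `V`. -/
noncomputable def riskDrift (θ : ℝ) (q q' : ι → EnergyData d) (x : Fin d → ℝ) : Fin d → ℝ :=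
  ∑ k, (q k).drift θ (q' k) x

/-- The minimizer of the entropic risk of the energies with parameters `q`. -/
noncomputable def riskArgmin (θ : ℝ) (q : ι → EnergyData d) : Fin d → ℝ :=
  Classical.epsilon fun x : Fin d → ℝ =>
    IsMinOn (fun z => entropicRisk θ fun k => (q k).energy z) univ x

/-- The parameters of families of strictly convex energies. -/
def convexEnergyData (ι : Type*) (d : ℕ) : Set (ι → EnergyData d) := {q | ∀ k, (q k).1.PosDef}

variable {q : ι → EnergyData d}

theorem transpose_eq_of_mem_convexEnergyData {ι : Type*} {q : ι → EnergyData d}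
    (hq : q ∈ convexEnergyData ι d) (k : ι) : (q k).1ᵀ = (q k).1 :=
  (conjTranspose_eq_transpose_of_trivial _).symm.trans (hq k).isHermitian

theorem hasDerivAt_add_smul {E : Type*} [NormedAddCommGroup E] [NormedSpace ℝ E] (x v : E)
    (s : ℝ) : HasDerivAt (fun u : ℝ => x + u • v) v s := by
  simpa only [one_smul] using ((hasDerivAt_id' s).smul_const v).const_add x

theorem hasDerivWithinAt_riskGradient (θ : ℝ) {q : ℝ → ι → EnergyData d} {q' : ι → EnergyData d}
    {x : ℝ → Fin d → ℝ} {x' : Fin d → ℝ} {s : Set ℝ} {t : ℝ} (hq : HasDerivWithinAt q q' s t)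
    (hx : HasDerivWithinAt x x' s t) (hqt : q t ∈ convexEnergyData ι d) :
    HasDerivWithinAt (fun u => riskGradient θ (q u) (x u))
      (riskHessian θ (q t) (x t) *ᵥ x' + riskDrift θ (q t) q' (x t)) s t := by
  convert! HasDerivWithinAt.fun_sum fun k (_ : k ∈ Finset.univ) =>
    EnergyData.hasDerivWithinAt_gradient θ (hasDerivWithinAt_pi.1 hq k) hx
      (transpose_eq_of_mem_convexEnergyData hqt k) using 1
  rw [riskHessian, riskDrift, Finset.sum_add_distrib, sum_mulVec]

theorem hasDerivAt_riskGradient_line (θ : ℝ) (hq : q ∈ convexEnergyData ι d)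
    (x v : Fin d → ℝ) (s : ℝ) :
    HasDerivAt (fun u : ℝ => riskGradient θ q (x + u • v))
      (riskHessian θ q (x + s • v) *ᵥ v) s := by
  convert! (hasDerivWithinAt_riskGradient θ (hasDerivWithinAt_const s univ q)
    (hasDerivAt_add_smul x v s).hasDerivWithinAt hq).hasDerivAt Filter.univ_mem using 1
  simp [riskDrift, EnergyData.drift_zero]

theorem hasDerivAt_totalWeight_line (θ : ℝ) (hq : q ∈ convexEnergyData ι d)
    (x v : Fin d → ℝ) :
    HasDerivAt (fun u : ℝ => totalWeight θ q (x + u • v))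
      (2 * θ * (riskGradient θ q x ⬝ᵥ v)) 0 := by
  convert! (HasDerivWithinAt.fun_sum fun k (_ : k ∈ Finset.univ) =>
    EnergyData.hasDerivWithinAt_weight θ (hasDerivWithinAt_const 0 univ (q k))
      (hasDerivAt_add_smul x v 0).hasDerivWithinAt
      (transpose_eq_of_mem_convexEnergyData hq k)).hasDerivAt Filter.univ_mem using 1
  simp only [EnergyData.energyRate_zero, mul_zero, add_zero, zero_smul, riskGradient,
    sum_dotProduct, Finset.mul_sum]
  exact Finset.sum_congr rfl fun k _ => by ring

theorem posDef_riskHessian [Nonempty ι] (hθ : 0 ≤ θ) (hq : q ∈ convexEnergyData ι d)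
    (x : Fin d → ℝ) : (riskHessian θ q x).PosDef :=
  posDef_sum Finset.univ_nonempty fun k _ => EnergyData.posDef_hessian hθ (hq k) x

theorem riskGradient_injective [Nonempty ι] (hθ : 0 ≤ θ) (hq : q ∈ convexEnergyData ι d) :
    Function.Injective (riskGradient θ q) := by
  intro x y hxy
  by_contra h_ne
  have hv : y - x ≠ 0 := sub_ne_zero.2 (Ne.symm h_ne)
  have h_deriv (s : ℝ) : HasDerivAt (fun u : ℝ => (y - x) ⬝ᵥ riskGradient θ q (x + u • (y - x)))
      ((y - x) ⬝ᵥ (riskHessian θ q (x + s • (y - x)) *ᵥ (y - x))) s :=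
    (dotProductCLM (Fin d) (y - x)).hasFDerivAt.comp_hasDerivAt s
      (hasDerivAt_riskGradient_line θ hq x (y - x) s)
  have h_mono := strictMono_of_deriv_pos fun s => by
    rw [(h_deriv s).deriv]
    exact (posDef_riskHessian hθ hq _).dotProduct_mulVec_pos hv
  have h_lt := h_mono zero_lt_one
  simp only [zero_smul, add_zero, one_smul, add_sub_cancel, hxy, lt_self_iff_false] at h_lt

open Filter in
theorem tendsto_totalWeight_cocompact_atTop [Nonempty ι] (hθ : 0 < θ)
    (hq : q ∈ convexEnergyData ι d) : Tendsto (totalWeight θ q) (cocompact (Fin d → ℝ)) atTop := by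
  obtain ⟨k⟩ := ‹Nonempty ι›
  have h_center : Tendsto (fun x : Fin d → ℝ => x - (q k).2.1) (cocompact _) (cocompact _) :=
    (Homeomorph.subRight (q k).2.1).isClosedEmbedding.tendsto_cocompact
  have h_weight : Tendsto ((q k).weight θ) (cocompact _) atTop :=
    Real.tendsto_exp_atTop.comp ((tendsto_atTop_add_const_right _ (q k).2.2
      ((tendsto_wnormSq_cocompact_atTop (hq k)).comp h_center)).const_mul_atTop hθ)
  exact tendsto_atTop_mono (fun x => Finset.single_le_sum
    (fun j _ => ((q j).weight_pos θ x).le) (Finset.mem_univ k)) h_weight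

theorem isMinOn_totalWeight_riskArgmin [Nonempty ι] (hθ : 0 < θ)
    (hq : q ∈ convexEnergyData ι d) : IsMinOn (totalWeight θ q) univ (riskArgmin θ q) := by
  have h_iff (x : Fin d → ℝ) : IsMinOn (fun z => entropicRisk θ fun k => (q k).energy z) univ x ↔
      IsMinOn (totalWeight θ q) univ x :=
    forall_congr' fun z => imp_congr_right fun _ => entropicRisk_le_entropicRisk_iff hθ
  have h_cont : Continuous (totalWeight θ q) := continuous_finsetSum _ fun k _ =>
    (EnergyData.contDiff_weight (k := 0) θ contDiff_const contDiff_id).continuous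
  obtain ⟨x, hx⟩ := h_cont.exists_forall_le (tendsto_totalWeight_cocompact_atTop hθ hq)
  exact (h_iff _).1 (Classical.epsilon_spec ⟨x, (h_iff x).2 fun z _ => hx z⟩)

theorem riskGradient_eq_zero_iff [Nonempty ι] (hθ : 0 < θ) (hq : q ∈ convexEnergyData ι d)
    {x : Fin d → ℝ} : riskGradient θ q x = 0 ↔ x = riskArgmin θ q := by
  have h_fermat : riskGradient θ q (riskArgmin θ q) = 0 := by
    set x₀ := riskArgmin θ q
    set g := riskGradient θ q x₀ with hg
    have h_min : IsLocalMin (fun u : ℝ => totalWeight θ q (x₀ + u • g)) 0 :=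
      .of_forall fun u => by
        simpa using isMinOn_totalWeight_riskArgmin hθ hq (mem_univ (x₀ + u • g))
    have h_zero := h_min.hasDerivAt_eq_zero (hasDerivAt_totalWeight_line θ hq x₀ g)
    rw [← hg] at h_zero
    exact dotProduct_self_eq_zero.1 ((mul_eq_zero_iff_left (by positivity)).1 h_zero)
  exact ⟨fun h => riskGradient_injective hθ.le hq (h.trans h_fermat.symm), fun h => h ▸ h_fermat⟩

theorem contDiff_riskGradient {E : Type*} [NormedAddCommGroup E] [NormedSpace ℝ E] {k : ℕ∞ω}
    {q : E → ι → EnergyData d} {x : E → Fin d → ℝ} (θ : ℝ) (hq : ContDiff ℝ k q)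
    (hx : ContDiff ℝ k x) : ContDiff ℝ k fun u => riskGradient θ (q u) (x u) :=
  ContDiff.sum fun j _ => EnergyData.contDiff_gradient θ (contDiff_pi.1 hq j) hx

theorem fderiv_riskGradient_inr (θ : ℝ) (hq : q ∈ convexEnergyData ι d) (x v : Fin d → ℝ) :
    fderiv ℝ (fun u : (ι → EnergyData d) × (Fin d → ℝ) => riskGradient θ u.1 u.2) (q, x) (0, v) =
      riskHessian θ q x *ᵥ v := by
  have h_line : HasDerivAt (fun u : ℝ => (q, x + u • v)) (0, v) 0 :=
    (hasDerivAt_const 0 q).prodMk (hasDerivAt_add_smul x v 0)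
  have h_fderiv := ((contDiff_riskGradient (k := 1) θ contDiff_fst contDiff_snd).differentiable
    one_ne_zero (q, x + (0 : ℝ) • v)).hasFDerivAt.comp_hasDerivAt 0 h_line
  have h_eq := h_fderiv.unique (hasDerivAt_riskGradient_line θ hq x v 0)
  rwa [zero_smul, add_zero] at h_eq

theorem isInvertible_fderiv_riskGradient_inr [Nonempty ι] (hθ : 0 ≤ θ)
    (hq : q ∈ convexEnergyData ι d) (x : Fin d → ℝ) :
    (fderiv ℝ (fun u : (ι → EnergyData d) × (Fin d → ℝ) => riskGradient θ u.1 u.2) (q, x) ∘L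
      .inr ℝ (ι → EnergyData d) (Fin d → ℝ)).IsInvertible := by
  set D := fderiv ℝ (fun u : (ι → EnergyData d) × (Fin d → ℝ) => riskGradient θ u.1 u.2) (q, x) ∘L
    .inr ℝ (ι → EnergyData d) (Fin d → ℝ)
  have h_inj : Function.Injective D := by
    have h_mulVec : ⇑D = (riskHessian θ q x).mulVec := funext (fderiv_riskGradient_inr θ hq x)
    rw [h_mulVec]
    exact mulVec_injective_of_isUnit (posDef_riskHessian hθ hq x).isUnit
  exact ⟨(LinearEquiv.ofInjectiveEndo D.toLinearMap h_inj).toContinuousLinearEquiv, rfl⟩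

theorem exists_contDiffAt_eventuallyEq_riskArgmin [Nonempty ι] (hθ : 0 < θ)
    (hq : q ∈ convexEnergyData ι d) : ∃ ψ : (ι → EnergyData d) → Fin d → ℝ,
      ContDiffAt ℝ ω ψ q ∧ riskArgmin θ =ᶠ[nhdsWithin q (convexEnergyData ι d)] ψ := by
  have h_inv := isInvertible_fderiv_riskGradient_inr hθ.le hq (riskArgmin θ q)
  have h_contDiff := (contDiff_riskGradient (k := ω) θ contDiff_fst contDiff_snd).contDiffAt
    (x := (q, riskArgmin θ q))
  refine ⟨h_contDiff.implicitFunction (by simp) h_inv,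
    h_contDiff.contDiffAt_implicitFunction (by simp) h_inv, ?_⟩
  filter_upwards [nhdsWithin_le_nhds (h_contDiff.eventually_apply_implicitFunction (by simp) h_inv),
    self_mem_nhdsWithin] with p hp hpD
  rw [(riskGradient_eq_zero_iff hθ hq).2 rfl] at hp
  exact ((riskGradient_eq_zero_iff hθ hpD).1 hp).symm

theorem contDiffOn_riskArgmin [Nonempty ι] (hθ : 0 < θ) :
    ContDiffOn ℝ ω (riskArgmin θ) (convexEnergyData ι d) := by
  intro q hq
  obtain ⟨ψ, hψ, h_eq⟩ := exists_contDiffAt_eventuallyEq_riskArgmin hθ hq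
  exact hψ.contDiffWithinAt.congr_of_eventuallyEq h_eq (h_eq.self_of_nhdsWithin hq)

theorem locallyLipschitzOn_riskArgmin [Nonempty ι] (hθ : 0 < θ) :
    LocallyLipschitzOn (convexEnergyData ι d) (riskArgmin θ) := by
  intro q hq
  obtain ⟨ψ, hψ, h_eq⟩ := exists_contDiffAt_eventuallyEq_riskArgmin hθ hq
  obtain ⟨K, U, hU, hK⟩ := (hψ.of_le le_top : ContDiffAt ℝ 1 ψ q).exists_lipschitzOnWith
  refine ⟨K, U ∩ {p | riskArgmin θ p = ψ p},
    Filter.inter_mem (nhdsWithin_le_nhds hU) h_eq, fun p hp p' hp' => ?_⟩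
  rw [hp.2, hp'.2]
  exact hK hp.1 hp'.1

theorem exists_dist_riskArgmin_le [Nonempty ι] (hθ : 0 < θ) {X : Type*} [TopologicalSpace X]
    {q : X → ι → EnergyData d} {s : Set X} (hs : IsCompact s) (hq : ContinuousOn q s)
    (hqs : MapsTo q s (convexEnergyData ι d)) : ∃ K : ℝ, ∀ a ∈ s, ∀ b ∈ s,
      dist (riskArgmin θ (q a)) (riskArgmin θ (q b)) ≤ K * dist (q a) (q b) := by
  have h_lip : LocallyLipschitzOn (q '' s) (riskArgmin θ) :=
    (locallyLipschitzOn_riskArgmin hθ).mono hqs.image_subset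
  obtain ⟨K, hK⟩ := h_lip.exists_lipschitzOnWith_of_compact (hs.image_of_continuousOn hq)
  exact ⟨K, fun a ha b hb =>
    hK.dist_le_mul _ (mem_image_of_mem q ha) _ (mem_image_of_mem q hb)⟩

theorem contDiffOn_riskArgmin_comp [Nonempty ι] (hθ : 0 < θ) {E : Type*} [NormedAddCommGroup E]
    [NormedSpace ℝ E] {k : ℕ∞ω} {q : E → ι → EnergyData d} {s : Set E} (hq : ContDiffOn ℝ k q s)
    (hqs : MapsTo q s (convexEnergyData ι d)) :
    ContDiffOn ℝ k (fun u => riskArgmin θ (q u)) s :=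
  ((contDiffOn_riskArgmin hθ).of_le le_top).comp hq hqs

theorem hasDerivWithinAt_riskArgmin [Nonempty ι] (hθ : 0 < θ) {q : ℝ → ι → EnergyData d}
    {q' : ι → EnergyData d} {s : Set ℝ} {t : ℝ} (hq : HasDerivWithinAt q q' s t)
    (hs : UniqueDiffWithinAt ℝ s t) (ht : t ∈ s) (hqs : MapsTo q s (convexEnergyData ι d)) :
    HasDerivWithinAt (fun u => riskArgmin θ (q u))
      (-((riskHessian θ (q t) (riskArgmin θ (q t)))⁻¹ *ᵥ
        riskDrift θ (q t) q' (riskArgmin θ (q t)))) s t := by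
  obtain ⟨x', h_argmin⟩ : ∃ x', HasDerivWithinAt (fun u => riskArgmin θ (q u)) x' s t :=
    ⟨_, ((contDiffOn_riskArgmin hθ (q t) (hqs ht)).differentiableWithinAt
      (by simp)).hasFDerivWithinAt.comp_hasDerivWithinAt t hq hqs⟩
  have h_unit := (posDef_riskHessian hθ.le (hqs ht) (riskArgmin θ (q t))).isUnit
  have h_gradient := hasDerivWithinAt_riskGradient θ hq h_argmin (hqs ht)
  have h_zero : HasDerivWithinAt (fun u => riskGradient θ (q u) (riskArgmin θ (q u))) 0 s t :=
    (hasDerivWithinAt_const t s 0).congr_of_mem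
      (fun u hu => (riskGradient_eq_zero_iff hθ (hqs hu)).2 rfl) ht
  have h_linear := eq_neg_of_add_eq_zero_left (hs.eq_deriv s h_gradient h_zero)
  convert! h_argmin using 1
  rw [← mulVec_neg, ← h_linear, mulVec_mulVec,
    nonsing_inv_mul _ ((isUnit_iff_isUnit_det _).1 h_unit), one_mulVec]

end EntropicRisk

namespace UncertainSystem

open scoped Matrix.Norms.Operator

variable {ι : Type*} {n m r : ℕ} (S : UncertainSystem ι n m r) (y : ℝ → Fin r → ℝ)

/-- The parameters `(P_k, x̂_k, r_k)` of the energies `𝒱_k(t, ·)`. -/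
noncomputable def params (t : ℝ) : ι → EnergyData n := fun k =>
  (S.precision k t, S.kalman y k t, S.residual y k t)

/-- The time derivative of `params`, with the derivatives of the filters taken from the filter
equation. -/
noncomputable def paramsDeriv (t : ℝ) : ι → EnergyData n := fun k =>
  (S.precisionDeriv k t, S.kalmanRHS y k t, wnormSq (S.Q k)⁻¹ (S.innovation y k t))

theorem mapsTo_params : MapsTo (S.params y) (Icc 0 S.T) (convexEnergyData ι n) :=
  fun _ ht k => S.posDef_precision k ht

variable {S y}

theorem memLp_paramsDeriv [Fintype ι] {p : ℝ≥0∞} (hp : 1 ≤ p)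
    (hy : MemLp y (2 * p) (volume.restrict (Ioo 0 S.T))) :
    MemLp (S.paramsDeriv y) p (volume.restrict (Ioo 0 S.T)) :=
  .of_eval fun k => .of_fst_snd ⟨memLp_of_continuousOn_Icc (S.continuousOn_precisionDeriv k) p,
    .of_fst_snd ⟨memLp_kalmanRHS hp (hy.mono_exponent (le_mul_of_one_le_left' one_le_two)) k,
      memLp_wnormSq_innovation hp hy k⟩⟩

theorem isPrimitiveOnInterval_residual (hy : MemLp y 2 (volume.restrict (Ioo 0 S.T))) (k : ι) :
    IsPrimitiveOnInterval (S.residual y k) (fun t => wnormSq (S.Q k)⁻¹ (S.innovation y k t))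
      0 S.T where
  intervalIntegrable := (intervalIntegrable_iff_integrableOn_Ioo_of_le S.T_pos.le).2 <|
    memLp_one_iff_integrable.1 (memLp_wnormSq_innovation le_rfl (by rwa [mul_one]) k)
  eq_add_integral t _ := by
    simp only [residual, innovation, intervalIntegral.integral_same, zero_add]

theorem continuousOn_paramsDeriv (hy : ContinuousOn y (Icc 0 S.T)) :
    ContinuousOn (S.paramsDeriv y) (Icc 0 S.T) := by
  refine continuousOn_pi.2 fun k => ?_
  have h_kalman : ContinuousOn (S.kalman y k) (Icc 0 S.T) :=
    (isKalmanFilter_kalman ((memLp_of_continuousOn_Icc hy 1).integrable le_rfl) k).1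
  have h_innovation : ContinuousOn (S.innovation y k) (Icc 0 S.T) :=
    hy.sub (continuousOn_mulVec continuousOn_const h_kalman)
  exact (S.continuousOn_precisionDeriv k).prodMk
    (((continuousOn_mulVec continuousOn_const h_kalman).add
      (continuousOn_mulVec (S.continuousOn_gain k) h_innovation)).prodMk
      (((dotProductCLM (Fin r)).continuous.comp_continuousOn h_innovation).clm_apply
        (continuousOn_mulVec continuousOn_const h_innovation)))

theorem isPrimitiveOnInterval_params [Fintype ι]
    (hy : MemLp y 2 (volume.restrict (Ioo 0 S.T))) :
    IsPrimitiveOnInterval (S.params y) (S.paramsDeriv y) 0 S.T :=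
  .pi fun k => (S.isPrimitiveOnInterval_precision k).prodMk
    ((isPrimitiveOnInterval_kalman (hy.integrable one_le_two) k).prodMk
      (isPrimitiveOnInterval_residual hy k))

theorem hasDerivWithinAt_params [Finite ι] (hy : ContinuousOn y (Icc 0 S.T)) {t : ℝ}
    (ht : t ∈ Icc 0 S.T) :
    HasDerivWithinAt (S.params y) (S.paramsDeriv y t) (Icc 0 S.T) t := by
  cases nonempty_fintype ι
  exact (isPrimitiveOnInterval_params (memLp_of_continuousOn_Icc hy 2)).hasDerivWithinAt S.T_pos.le
    (continuousOn_paramsDeriv hy) ht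

variable [Fintype ι]

theorem estimator_eq_riskArgmin (θ : ℝ) :
    S.estimator θ y = fun t => riskArgmin θ (S.params y t) :=
  rfl

theorem matM_eq_riskHessian (θ t : ℝ) (x : Fin n → ℝ) :
    S.matM θ y t x = riskHessian θ (S.params y t) x :=
  rfl

theorem vecV_eq_riskDrift {t : ℝ} (θ : ℝ)
    (h : ∀ k, S.kalmanDeriv y k t = S.kalmanRHS y k t) (x : Fin n → ℝ) :
    S.vecV θ y t x = riskDrift θ (S.params y t) (S.paramsDeriv y t) x := by
  simp only [vecV, riskDrift, EnergyData.drift, Finset.sum_add_distrib, Finset.sum_neg_distrib,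
    Finset.smul_sum, h]
  rfl

theorem contDiffOn_params (hy : ContinuousOn y (Icc 0 S.T)) :
    ContDiffOn ℝ 1 (S.params y) (Icc 0 S.T) := by
  have h_unique := uniqueDiffOn_Icc S.T_pos
  refine (contDiffOn_one_iff_derivWithin h_unique).2 ⟨fun t ht =>
    (hasDerivWithinAt_params hy ht).differentiableWithinAt, ?_⟩
  exact (continuousOn_paramsDeriv hy).congr fun t ht =>
    (hasDerivWithinAt_params hy ht).derivWithin (h_unique t ht)

variable [Nonempty ι] {θ : ℝ}

theorem isUnit_matM (hθ : 0 ≤ θ) {t : ℝ} (ht : t ∈ Icc 0 S.T) (x : Fin n → ℝ) :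
    IsUnit (S.matM θ y t x) := by
  rw [matM_eq_riskHessian]
  exact (posDef_riskHessian hθ (S.mapsTo_params y ht) x).isUnit

theorem hasDerivWithinAt_estimator (hθ : 0 < θ) {t : ℝ} (ht : t ∈ Icc 0 S.T)
    (h : HasDerivWithinAt (S.params y) (S.paramsDeriv y t) (Icc 0 S.T) t) :
    HasDerivWithinAt (S.estimator θ y) (S.estimatorDeriv θ y t) (Icc 0 S.T) t := by
  have h_kalman (k : ι) : S.kalmanDeriv y k t = S.kalmanRHS y k t :=
    kalmanDeriv_eq ht (hasDerivWithinAt_pi.1 h k).snd.fst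
  rw [estimatorDeriv, vecV_eq_riskDrift θ h_kalman, matM_eq_riskHessian, estimator_eq_riskArgmin]
  exact hasDerivWithinAt_riskArgmin hθ h (uniqueDiffOn_Icc S.T_pos t ht) ht (S.mapsTo_params y)

theorem exists_dist_estimator_le (hθ : 0 < θ) (h : ContinuousOn (S.params y) (Icc 0 S.T)) :
    ∃ K : ℝ, ∀ s ∈ Icc 0 S.T, ∀ t ∈ Icc 0 S.T,
      dist (S.estimator θ y s) (S.estimator θ y t) ≤ K * dist (S.params y s) (S.params y t) := by
  rw [estimator_eq_riskArgmin]
  exact exists_dist_riskArgmin_le hθ isCompact_Icc h (S.mapsTo_params y)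

theorem ae_hasDerivAt_estimator (hθ : 0 < θ) (hy : MemLp y 2 (volume.restrict (Ioo 0 S.T))) :
    ∀ᵐ t, t ∈ Ioo 0 S.T → HasDerivAt (S.estimator θ y) (S.estimatorDeriv θ y t) t := by
  filter_upwards [(isPrimitiveOnInterval_params hy).ae_hasDerivAt] with t ht hmem
  exact (hasDerivWithinAt_estimator hθ (Ioo_subset_Icc_self hmem)
    (ht hmem).hasDerivWithinAt).hasDerivAt (Icc_mem_nhds hmem.1 hmem.2)

theorem isPrimitiveOnInterval_estimator (hθ : 0 < θ)
    (hy : MemLp y 2 (volume.restrict (Ioo 0 S.T))) :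
    IsPrimitiveOnInterval (S.estimator θ y) (S.estimatorDeriv θ y) 0 S.T := by
  have h_params := isPrimitiveOnInterval_params hy
  have h_uIcc : uIcc 0 S.T = Icc 0 S.T := uIcc_of_le S.T_pos.le
  obtain ⟨K, hK⟩ := exists_dist_estimator_le hθ (h_uIcc ▸ h_params.continuousOn)
  exact h_params.of_dist_le S.T_pos.le (h_uIcc ▸ hK) (ae_hasDerivAt_estimator hθ hy)

theorem memLp_estimatorDeriv (hθ : 0 < θ) {p : ℝ≥0∞} (hp : 1 ≤ p)
    (hy : MemLp y (2 * p) (volume.restrict (Ioo 0 S.T))) :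
    MemLp (S.estimatorDeriv θ y) p (volume.restrict (Ioo 0 S.T)) := by
  have hy₂ : MemLp y 2 (volume.restrict (Ioo 0 S.T)) :=
    hy.mono_exponent (le_mul_of_one_le_right' hp)
  have h_params := isPrimitiveOnInterval_params hy₂
  have h_meas : AEStronglyMeasurable (S.estimatorDeriv θ y) (volume.restrict (Ioo 0 S.T)) :=
    ((intervalIntegrable_iff_integrableOn_Ioo_of_le S.T_pos.le).1
      (isPrimitiveOnInterval_estimator hθ hy₂).intervalIntegrable).aestronglyMeasurable
  obtain ⟨K, hK⟩ := exists_dist_estimator_le hθ (uIcc_of_le S.T_pos.le ▸ h_params.continuousOn)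
  refine (memLp_paramsDeriv hp hy).of_le_mul (c := K) h_meas
    ((ae_restrict_iff' measurableSet_Ioo).2 ?_)
  filter_upwards [h_params.ae_hasDerivAt, ae_hasDerivAt_estimator hθ hy₂] with t ht ht' hmem
  exact norm_le_mul_norm_of_dist_le (ht hmem) (ht' hmem) <| Filter.mem_of_superset
    (Icc_mem_nhds hmem.1 hmem.2) fun s hs => hK s hs t (Ioo_subset_Icc_self hmem)

theorem contDiffOn_estimator (hθ : 0 < θ) (h : ContDiffOn ℝ 1 (S.params y) (Icc 0 S.T)) :
    ContDiffOn ℝ 1 (S.estimator θ y) (Icc 0 S.T) := by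
  rw [estimator_eq_riskArgmin]
  exact contDiffOn_riskArgmin_comp hθ h (S.mapsTo_params y)

end UncertainSystem

theorem theorem3p8_general {ι : Type*} [Fintype ι] [Nonempty ι] {n m r : ℕ}
    (S : UncertainSystem ι n m r) (θ : ℝ) (hθ : 0 < θ) :
    (∀ (p : ℝ≥0∞) (_ : 1 ≤ p) (y : ℝ → Fin r → ℝ),
      MemLp y (2 * p) (volume.restrict (Ioo 0 S.T)) →
        MemW1p S.T p (S.estimator θ y) ∧
        (∀ t ∈ Icc 0 S.T, IsUnit (S.matM θ y t (S.estimator θ y t))) ∧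
        HasWeakDeriv S.T (S.estimator θ y) (S.estimatorDeriv θ y)) ∧
    (∀ y : ℝ → Fin r → ℝ, ContinuousOn y (Icc 0 S.T) →
        ContDiffOn ℝ 1 (S.estimator θ y) (Icc 0 S.T) ∧
        (∀ t ∈ Icc 0 S.T, IsUnit (S.matM θ y t (S.estimator θ y t))) ∧
        ∀ t ∈ Icc 0 S.T,
          HasDerivWithinAt (S.estimator θ y) (S.estimatorDeriv θ y t) (Icc 0 S.T) t) := by
  refine ⟨fun p hp y hy => ?_, fun y hy => ?_⟩
  · have hy₂ : MemLp y 2 (volume.restrict (Ioo 0 S.T)) :=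
      hy.mono_exponent (le_mul_of_one_le_right' hp)
    have h_primitive := UncertainSystem.isPrimitiveOnInterval_estimator hθ hy₂
    have h_weak := h_primitive.hasWeakDeriv S.T_pos.le
    have h_memLp : MemLp (S.estimator θ y) p (volume.restrict (Ioo 0 S.T)) :=
      memLp_of_continuousOn_Icc (uIcc_of_le S.T_pos.le ▸ h_primitive.continuousOn) p
    exact ⟨⟨h_memLp, _, UncertainSystem.memLp_estimatorDeriv hθ hp hy, h_weak⟩,
      fun t ht => UncertainSystem.isUnit_matM hθ.le ht _, h_weak⟩
  · exact ⟨UncertainSystem.contDiffOn_estimator hθ (UncertainSystem.contDiffOn_params hy),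
      fun t ht => UncertainSystem.isUnit_matM hθ.le ht _,
      fun t ht => UncertainSystem.hasDerivWithinAt_estimator hθ ht
        (UncertainSystem.hasDerivWithinAt_params hy ht)⟩

theorem theorem3p8 {ι : Type*} [Fintype ι] [Nonempty ι] {n m r : ℕ}
    (S : UncertainSystem ι n m r) (θ : ℝ) (hθ : 0 < θ) :
    (∀ (p : ℕ) (_ : 1 ≤ p) (y : ℝ → Fin r → ℝ),
      MemLp y (2 * (p : ℝ≥0∞)) (volume.restrict (Ioo 0 S.T)) →
        MemW1p S.T (p : ℝ≥0∞) (S.estimator θ y) ∧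
        (∀ t ∈ Icc 0 S.T, IsUnit (S.matM θ y t (S.estimator θ y t))) ∧
        HasWeakDeriv S.T (S.estimator θ y) (S.estimatorDeriv θ y)) ∧
    (∀ y : ℝ → Fin r → ℝ, ContinuousOn y (Icc 0 S.T) →
        ContDiffOn ℝ 1 (S.estimator θ y) (Icc 0 S.T) ∧
        (∀ t ∈ Icc 0 S.T, IsUnit (S.matM θ y t (S.estimator θ y t))) ∧
        ∀ t ∈ Icc 0 S.T,
          HasDerivWithinAt (S.estimator θ y) (S.estimatorDeriv θ y t) (Icc 0 S.T) t) :=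
  ⟨fun p hp => (theorem3p8_general S θ hθ).1 p (Nat.one_le_cast.2 hp),
    (theorem3p8_general S θ hθ).2⟩
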